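/- Let $d\ge 2$, let $B_1=\{x\in\mathbb R^d:|x|<1\}$ and $I=[0,1]$. Fix a nonnegative function $\phi\in C_c^\infty(\mathbb R)$ supported in $(2^{-1},2)$ with $\sum_{k\in\mathbb Z}\phi(2^{-k}t)=1$ for all $t>0$. For $f\in L^2(\mathbb R^d)$ with Fourier transform $\widehat f(\xi)=\int_{\mathbb R^d} e^{-ix\cdot\xi}f(x)\,dx$ (extended to $L^2$), let $P_kf$ be defined by $\widehat{P_kf}(\xi)=\phi(2^{-k}|\xi|)\widehat f(\xi)$, and let $$e^{it\sqrt{-\Delta}}P_kf(x)=(2\pi)^{-d}\int_{\mathbb R^d}e^{i(x\cdot\xi+t|\xi|)}\,\widehat{P_kf}(\xi)\,d\xi .$$ Suppose that $$s>\max\Big\{\frac d4,\frac58\Big\}.$$ Then there is a constant $C>0$, depending only on $d$, $s$ and $\phi$, such that for every integer $k\ge1$, every (finite or countably infinite) orthonormal system $(f_j)_j$ in $L^2(\mathbb R^d)$ and every complex sequence $\lambda=(\lambda_j)_j\in\ell^2$, the series $\sum_j\lambda_j|e^{it\sqrt{-\Delta}}P_kf_j(x)|^2$ converges absolutely for all $(x,t)\in\mathbb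 R^d\times\mathbb R$, defines a measurable function of $(x,t)$, and satisfies $$\Big\|\sum_j\lambda_j\,|e^{it\sqrt{-\Delta}}P_kf_j|^2\Big\|_{L^2_x(B_1)L^\infty_t(I)}\le C\,2^{2sk}\,\|\lambda\|_{\ell^2},$$ where $\|F\|_{L^2_x(B_1)L^\infty_t(I)}=\big(\int_{B_1}(\operatorname{ess\,sup}_{t\in I}|F(x,t)|)^2\,dx\big)^{1/2}$. -/

import Mathlib

open MeasureTheory FourierTransform
open scoped ENNReal ContDiff

noncomputable section

namespace HalfWave

/-- `L²(ℝᵈ)`, complex valued. -/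
abbrev L2 (d : ℕ) : Type :=
  Lp ℂ 2 (volume : Measure (EuclideanSpace ℝ (Fin d)))

/-- A Littlewood–Paley cutoff: a nonnegative smooth function `φ` on `ℝ` with compact support
contained in `(1/2, 2)` such that `∑_{k ∈ ℤ} φ (t / 2 ^ k) = 1` for every `t > 0`. -/
structure DyadicCutoff where
  /-- The underlying function. -/
  toFun : ℝ → ℝ
  smooth : ContDiff ℝ ∞ toFun
  compact : HasCompactSupport toFun
  support : tsupport toFun ⊆ Set.Ioo (1 / 2) 2
  nonneg : ∀ t, 0 ≤ toFun t
  partition : ∀ t : ℝ, 0 < t → HasSum (fun k : ℤ => toFun (t / (2 : ℝ) ^ k)) 1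

/-- The symbol of the Littlewood–Paley projection `P_k`. With the convention
`∫ f(x) exp(-i x·η) dx` for the Fourier transform it is `φ(2^{-k}|η|)`. Mathlib's Fourier transform
is `∫ f(x) exp(-2πi x·ξ) dx`, so that `η = 2πξ`, whence the factor `2π`. -/
def lpSymbol (d : ℕ) (φ : DyadicCutoff) (k : ℤ) (ξ : EuclideanSpace ℝ (Fin d)) : ℂ :=
  (φ.toFun (2 * Real.pi * ‖ξ‖ / (2 : ℝ) ^ k) : ℂ)

/-- The symbol of `P_k` is bounded and measurable. -/
theorem memLp_lpSymbol (d : ℕ) (φ : DyadicCutoff) (k : ℤ) :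
    MemLp (lpSymbol d φ k) ∞ (volume : Measure (EuclideanSpace ℝ (Fin d))) := by
  obtain ⟨C, hC⟩ := φ.compact.exists_bound_of_continuous φ.smooth.continuous
  have hc : Continuous (lpSymbol d φ k) := by
    have := φ.smooth.continuous
    unfold lpSymbol
    fun_prop
  refine memLp_top_of_bound hc.aestronglyMeasurable C (Filter.Eventually.of_forall fun ξ => ?_)
  simpa [lpSymbol] using hC (2 * Real.pi * ‖ξ‖ / (2 : ℝ) ^ k)

/-- The Littlewood–Paley projection `P_k` on `L²(ℝᵈ)`: the Fourier multiplier operator with symbol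
`lpSymbol d φ k`, defined through the `L²` Fourier transform. -/
def lpProj (d : ℕ) (φ : DyadicCutoff) (k : ℤ) (f : L2 d) : L2 d :=
  𝓕⁻ ((memLp_lpSymbol d φ k).toLp (lpSymbol d φ k) • 𝓕 f : L2 d)

/-- The Fourier transform of `P_k f` is the symbol times the Fourier transform of `f`. -/
theorem fourier_lpProj (d : ℕ) (φ : DyadicCutoff) (k : ℤ) (f : L2 d) :
    (𝓕 (lpProj d φ k f) : L2 d) =ᵐ[volume] fun ξ => lpSymbol d φ k ξ * (𝓕 f : L2 d) ξ := by
  unfold lpProj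
  rw [FourierTransform.fourier_fourierInv_eq]
  filter_upwards [Lp.coeFn_lpSMul (r := 2) ((memLp_lpSymbol d φ k).toLp (lpSymbol d φ k))
    (𝓕 f : L2 d), (memLp_lpSymbol d φ k).coeFn_toLp] with ξ h1 h2
  simp [h1, h2]

/-- The half-wave propagator
`e^{it√(-Δ)} f(x) = (2π)^{-d} ∫ e^{i(x·η + t|η|)} f^(η) dη`,
where `f^(η) = ∫ f(x) e^{-i x·η} dx`, written in the variable `ξ = η / (2π)` of Mathlib's Fourier
transform. The integral converges absolutely as soon as the `L²` Fourier transform of `f` is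
integrable; in particular for all frequency-localised `f` such as `f = P_k g`. -/
def halfWave (d : ℕ) (f : L2 d) (x : EuclideanSpace ℝ (Fin d)) (t : ℝ) : ℂ :=
  ∫ ξ : EuclideanSpace ℝ (Fin d),
    Complex.exp (((2 * Real.pi * inner ℝ x ξ + t * (2 * Real.pi * ‖ξ‖) : ℝ) : ℂ) * Complex.I) *
      (𝓕 f : L2 d) ξ

/-- The weighted density `∑_j λ_j |e^{it√(-Δ)} P_k f_j (x)|²`. -/
def density (d : ℕ) (φ : DyadicCutoff) (k : ℤ) {ι : Type} (lam : ι → ℂ) (f : ι → L2 d)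
    (x : EuclideanSpace ℝ (Fin d)) (t : ℝ) : ℂ :=
  ∑' j, lam j * ((‖halfWave d (lpProj d φ k (f j)) x t‖ ^ 2 : ℝ) : ℂ)

/-- The mixed norm `‖F‖_{L^p_x(μ) L^q_t(ν)}`, where the inner norm is taken in `t`. -/
def mixedNorm {X T : Type*} [MeasurableSpace X] [MeasurableSpace T] (p q : ℝ≥0∞)
    (μ : Measure X) (ν : Measure T) (F : X → T → ℂ) : ℝ≥0∞ :=
  eLpNorm (fun x => eLpNorm (fun t => F x t) q ν) p μ

end HalfWave

end

open scoped Pointwise ComplexConjugate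

/-! The proof linearises the supremum in time, then combines duality with a Hilbert–Schmidt bound.
Let `ρ` be the density with weights `|λ_j|`. Replacing the supremum over `t` by a measurable choice
`t = T(x)` leaves `X = ∫_{B_1} ρ(x,T(x))² dx` to be bounded. With `g = 1_{B_1} ρ(·,T(·))`, one has
`X = ∑ |λ_j| ∫ g |U f_j(x,T(x))|² dx`, where `U` is the localised propagator. By Cauchy–Schwarz in
`j` and Bessel, `X²` is at most `‖λ‖²` times the squared Hilbert–Schmidt norm of the Gram kernel
`A(ξ,η)` on `|ξ|,|η| ≤ R = 2^k` (`tsum_lintegral_halfWave_sq_le`).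

Up to conjugation `A(ξ,η)` is the space-time Fourier transform of the measure `g(x) δ(t - T(x))` at
`(η - ξ, |η| - |ξ|)`. Put `ζ = η - ξ` and cut the values of `|ξ+ζ| - |ξ|` into windows `[n, n+1)`.
As `|T| ≤ 1`, the transform on one window is controlled by a function of `ζ` alone, whose integral
is `≲ ‖g‖₂²` by Plancherel in `x`. What remains is the volume of those `ξ` that put the phase in
window `n`. The curvature of the cone transverse to `ζ` bounds it by `R^(4s) w n` with `w` summable
(`exists_summable_volume_phaseSet_le`).

Since `‖g‖₂² = X`, this yields `X² ≤ C R^(4s) ‖λ‖² X`, and `X` cancels because it is finite a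
priori. -/

namespace HalfWave


/-! ### Fourier integrals and Plancherel on `L¹ ∩ L²`. -/

open SchwartzMap in
/-- On `L¹ ∩ L²` the `L²` Fourier transform is given by the Fourier integral. -/
theorem fourier_toLp_ae_eq {d : ℕ} {G : EuclideanSpace ℝ (Fin d) → ℂ} (h1 : Integrable G)
    (h2 : MemLp G 2) : (𝓕 (h2.toLp G) : L2 d) =ᵐ[volume] 𝓕 G := by
  have hloc : LocallyIntegrable (𝓕 (h2.toLp G) : L2 d) :=
    (Lp.memLp (𝓕 (h2.toLp G) : L2 d)).locallyIntegrable (by norm_num)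
  have hcont : Continuous (𝓕 G) :=
    VectorFourier.fourierIntegral_continuous Real.continuous_fourierChar
      (by exact continuous_inner) h1
  -- Both sides are tested against smooth compactly supported functions: one through the
  -- distributional transform, the other through the multiplication formula.
  refine ae_eq_of_integral_contDiff_smul_eq hloc hcont.locallyIntegrable fun g hg hgc => ?_
  set gs : 𝓢(EuclideanSpace ℝ (Fin d), ℂ) :=
    (hgc.comp_left (g := ((↑) : ℝ → ℂ)) (by simp)).toSchwartzMap
      (Complex.ofRealCLM.contDiff.comp hg) with hgs
  have hgs' : ∀ x, gs x = (g x : ℂ) := fun x => rfl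
  have key := congrArg (fun T => T gs) (Lp.fourier_toTemperedDistribution_eq (h2.toLp G))
  have e1 : ∫ x, (𝓕 gs) x • (h2.toLp G) x = ∫ x, gs x • (𝓕 (h2.toLp G) : L2 d) x := by
    simpa [Lp.toTemperedDistribution_apply, TemperedDistribution.fourier_apply] using key
  have e2 : ∫ x, (𝓕 gs) x • (h2.toLp G) x = ∫ x, (𝓕 (gs : _ → ℂ)) x • G x := by
    refine integral_congr_ae ?_
    filter_upwards [h2.coeFn_toLp] with x hx
    rw [hx, SchwartzMap.fourier_coe]
  have e3 : ∫ x, (𝓕 (gs : _ → ℂ)) x • G x = ∫ x, gs x • (𝓕 G) x := by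
    have := VectorFourier.integral_fourierIntegral_smul_eq_flip (μ := volume) (ν := volume)
      (L := innerₗ (EuclideanSpace ℝ (Fin d))) Real.continuous_fourierChar
      (by exact continuous_inner) gs.integrable h1
    rw [flip_innerₗ] at this
    exact this
  have e4 : ∫ x, gs x • (𝓕 (h2.toLp G) : L2 d) x = ∫ x, gs x • (𝓕 G) x := by rw [← e1, e2, e3]
  simpa [hgs'] using e4

/-- Plancherel's identity for the Fourier integral on `L¹ ∩ L²`. -/
theorem lintegral_enorm_fourier_sq {d : ℕ} {G : EuclideanSpace ℝ (Fin d) → ℂ} (h1 : Integrable G)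
    (h2 : MemLp G 2) : ∫⁻ ζ, ‖𝓕 G ζ‖ₑ ^ 2 = ∫⁻ x, ‖G x‖ₑ ^ 2 := by
  have hn : eLpNorm (𝓕 G) 2 volume = eLpNorm G 2 volume := by
    rw [← eLpNorm_congr_ae (fourier_toLp_ae_eq h1 h2), ← Lp.enorm_def,
      ← eLpNorm_congr_ae h2.coeFn_toLp, ← Lp.enorm_def, ← ofReal_norm, ← ofReal_norm,
      Lp.norm_fourier_eq]
  have h := congrArg (· ^ 2) hn
  simpa [eLpNorm_nnreal_pow_eq_lintegral (p := 2)] using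
    (eLpNorm_nnreal_pow_eq_lintegral (p := 2) (f := 𝓕 G) (μ := volume) (by norm_num)).symm.trans
      ((congrArg (· ^ ((2 : NNReal) : ℝ)) hn).trans
        (eLpNorm_nnreal_pow_eq_lintegral (p := 2) (f := G) (μ := volume) (by norm_num)))


/-! ### Volume of the windows of `‖ξ + ζ‖ - ‖ξ‖`. -/

theorem hasDerivAt_sqrt_sq_add {v : ℝ} (hv : 0 < v) (u : ℝ) :
    HasDerivAt (fun u : ℝ => √(u ^ 2 + v)) (u / √(u ^ 2 + v)) u := by
  have h := (((hasDerivAt_id u).pow 2).add_const v).sqrt (by simp; positivity)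
  convert! h using 1
  simp
  field_simp

theorem hasDerivAt_div_sqrt_sq_add {v : ℝ} (hv : 0 < v) (u : ℝ) :
    HasDerivAt (fun u : ℝ => u / √(u ^ 2 + v)) (v / (√(u ^ 2 + v)) ^ 3) u := by
  have hp : 0 < √(u ^ 2 + v) := by positivity
  have h := (hasDerivAt_id u).div (hasDerivAt_sqrt_sq_add hv u) hp.ne'
  convert! h using 1
  have hs : √(u ^ 2 + v) ^ 2 = u ^ 2 + v := Real.sq_sqrt (by positivity)
  simp only [id]
  field_simp
  rw [hs]
  ring

theorem sq_add_le_one_of_mem_Icc {v x y z : ℝ} (hx : x ^ 2 + v ≤ 1) (hy : y ^ 2 + v ≤ 1)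
    (hz : z ∈ Set.Icc x y) : z ^ 2 + v ≤ 1 := by
  obtain ⟨h1, h2⟩ := hz
  nlinarith [sq_nonneg (x + y), mul_nonneg (sub_nonneg.2 h1) (sub_nonneg.2 h2)]

/-- The derivative is `v (u² + v)^(-3/2)`, and inside the unit ball this is at least `v`. -/
theorem mul_sub_le_div_sqrt_sub {v x y : ℝ} (hv : 0 < v) (hxy : x ≤ y) (hx : x ^ 2 + v ≤ 1)
    (hy : y ^ 2 + v ≤ 1) : v * (y - x) ≤ y / √(y ^ 2 + v) - x / √(x ^ 2 + v) := by
  refine (convex_Icc x y).mul_sub_le_image_sub_of_le_deriv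
    (f := fun u : ℝ => u / √(u ^ 2 + v))
    (fun u _ => (hasDerivAt_div_sqrt_sq_add hv u).continuousAt.continuousWithinAt)
    (fun u _ => (hasDerivAt_div_sqrt_sq_add hv u).differentiableAt.differentiableWithinAt)
    (fun u hu => ?_) x (Set.left_mem_Icc.2 hxy) y (Set.right_mem_Icc.2 hxy) hxy
  rw [(hasDerivAt_div_sqrt_sq_add hv u).deriv, le_div_iff₀ (by positivity)]
  have h1 : √(u ^ 2 + v) ≤ 1 :=
    Real.sqrt_le_one.2 (sq_add_le_one_of_mem_Icc hx hy (interior_subset hu))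
  have h2 : √(u ^ 2 + v) ^ 3 ≤ 1 := pow_le_one₀ (Real.sqrt_nonneg _) h1
  nlinarith

/-- The only curvature input: moving along `ζ`, the phase grows at rate at least `L v`. The rate
degenerates only as `v → 0`, where `ξ` is parallel to `ζ` and the cone is flat. -/
theorem mul_sub_le_phase_sub {L v x y : ℝ} (hL : 0 < L) (hv : 0 < v) (hxy : x ≤ y)
    (hx : x ^ 2 + v ≤ 1) (hx' : (x + L) ^ 2 + v ≤ 1) (hy : y ^ 2 + v ≤ 1)
    (hy' : (y + L) ^ 2 + v ≤ 1) :
    L * v * (y - x) ≤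
      (√((y + L) ^ 2 + v) - √(y ^ 2 + v)) - (√((x + L) ^ 2 + v) - √(x ^ 2 + v)) := by
  have hd : ∀ u : ℝ, HasDerivAt (fun u : ℝ => √((u + L) ^ 2 + v) - √(u ^ 2 + v))
      ((u + L) / √((u + L) ^ 2 + v) - u / √(u ^ 2 + v)) u := fun u =>
    ((hasDerivAt_sqrt_sq_add hv (u + L)).comp_add_const u L).sub (hasDerivAt_sqrt_sq_add hv u)
  refine (convex_Icc x y).mul_sub_le_image_sub_of_le_deriv
    (f := fun u : ℝ => √((u + L) ^ 2 + v) - √(u ^ 2 + v))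
    (fun u _ => (hd u).continuousAt.continuousWithinAt)
    (fun u _ => (hd u).differentiableAt.differentiableWithinAt)
    (fun u hu => ?_) x (Set.left_mem_Icc.2 hxy) y (Set.right_mem_Icc.2 hxy) hxy
  rw [(hd u).deriv]
  have hu' := interior_subset hu
  have h := mul_sub_le_div_sqrt_sub hv (x := u) (y := u + L) (by linarith)
    (sq_add_le_one_of_mem_Icc hx hy hu')
    (sq_add_le_one_of_mem_Icc hx' hy' ⟨by linarith [hu'.1], by linarith [hu'.2]⟩)
  linarith

/-- The set of those `u` for which `(u, w)`, `|w|² = v`, and its translate by `L` in the first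
variable lie in the unit ball, the difference of their norms being in a window of length `h`. -/
def sliceSet (L v a h : ℝ) : Set ℝ :=
  {u | u ^ 2 + v ≤ 1 ∧ (u + L) ^ 2 + v ≤ 1 ∧
    a ≤ √((u + L) ^ 2 + v) - √(u ^ 2 + v) ∧ √((u + L) ^ 2 + v) - √(u ^ 2 + v) < a + h}

theorem volume_sliceSet_le {L v h : ℝ} (a : ℝ) (hL : 0 < L) (hv : 0 < v) :
    volume (sliceSet L v a h) ≤ ENNReal.ofReal (h / (L * v)) := by
  refine (Real.volume_le_diam _).trans (Metric.ediam_le fun x hx y hy => ?_)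
  rw [edist_dist]
  refine ENNReal.ofReal_le_ofReal ?_
  wlog hxy : x ≤ y generalizing x y
  · rw [dist_comm]; exact this y hy x hx (le_of_not_ge hxy)
  have h1 := mul_sub_le_phase_sub hL hv hxy hx.1 hx.2.1 hy.1 hy.2.1
  rw [dist_comm, Real.dist_eq, abs_of_nonneg (sub_nonneg.2 hxy), le_div_iff₀ (by positivity)]
  linarith [hx.2.2.1, hy.2.2.2]

theorem volume_sliceSet_le_two {L v h : ℝ} (a : ℝ) (hv : 0 ≤ v) :
    volume (sliceSet L v a h) ≤ 2 := by
  refine (measure_mono (t := Set.Icc (-1) 1) fun u hu => ?_).trans (by norm_num)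
  exact abs_le.1 (abs_le_one_iff_mul_self_le_one.2 (by nlinarith [hu.1]))

theorem sliceSet_eq_empty {L v h : ℝ} (a : ℝ) (hv : 1 < v) : sliceSet L v a h = ∅ := by
  ext u
  simp only [sliceSet, Set.mem_ofPred_eq, Set.mem_empty_iff_false, iff_false]
  rintro ⟨h1, -⟩
  nlinarith [sq_nonneg u]

/-- Interpolates between the lengths `h / (L v)` and `2`: the first is not integrable over the
transverse variable in low dimension, while `v ^ (-θ)` is for small `θ`. -/
theorem volume_sliceSet_le_rpow {L v h θ : ℝ} (a : ℝ) (hL : 0 < L) (hv : 0 < v) (hh : 0 ≤ h)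
    (hθ : 0 ≤ θ) (hθ1 : θ ≤ 1) :
    volume (sliceSet L v a h) ≤ ENNReal.ofReal (2 * (h / L) ^ θ * v ^ (-θ)) := by
  have hX : 0 ≤ h / (L * v) := by positivity
  have e : 2 * (h / L) ^ θ * v ^ (-θ) = 2 * (h / (L * v)) ^ θ := by
    rw [Real.rpow_neg hv.le, ← div_div, Real.div_rpow (by positivity) hv.le]
    ring
  rw [e]
  rcases le_total (h / (L * v)) 1 with h1 | h1
  · refine (volume_sliceSet_le a hL hv).trans (ENNReal.ofReal_le_ofReal ?_)
    have := Real.rpow_le_rpow_of_exponent_ge_of_imp hX h1 hθ1 (by intro h0 h0'; simp_all)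
    rw [Real.rpow_one] at this
    have h3 : 0 ≤ (h / (L * v)) ^ θ := by positivity
    linarith
  · refine (volume_sliceSet_le_two a hv.le).trans ?_
    rw [← ENNReal.ofReal_ofNat]
    refine ENNReal.ofReal_le_ofReal ?_
    have := Real.one_le_rpow h1 hθ
    linarith

/-- The part of the ball of radius `R` on which `‖ξ + ζ‖ - ‖ξ‖` lies in the window
`[a, a + h)`. -/
def phaseSet {m : ℕ} (ζ : EuclideanSpace ℝ (Fin m)) (R a h : ℝ) :
    Set (EuclideanSpace ℝ (Fin m)) :=
  {ξ | ‖ξ‖ ≤ R ∧ ‖ξ + ζ‖ ≤ R ∧ a ≤ ‖ξ + ζ‖ - ‖ξ‖ ∧ ‖ξ + ζ‖ - ‖ξ‖ < a + h}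

theorem measurableSet_phaseSet {m : ℕ} (ζ : EuclideanSpace ℝ (Fin m)) (R a h : ℝ) :
    MeasurableSet (phaseSet ζ R a h) := by
  have h1 : Measurable fun ξ : EuclideanSpace ℝ (Fin m) => ‖ξ‖ := by fun_prop
  have h2 : Measurable fun ξ : EuclideanSpace ℝ (Fin m) => ‖ξ + ζ‖ := by fun_prop
  exact (measurableSet_le h1 measurable_const).inter
    ((measurableSet_le h2 measurable_const).inter
    ((measurableSet_le measurable_const (h2.sub h1)).inter
    (measurableSet_lt (h2.sub h1) measurable_const)))

/-- Euclidean space has an isometry taking a multiple of the first basis vector to a given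
vector. -/
theorem exists_isometry_single_eq {m : ℕ} {ζ : EuclideanSpace ℝ (Fin (m + 1))} (hζ : ζ ≠ 0) :
    ∃ T : EuclideanSpace ℝ (Fin (m + 1)) ≃ₗᵢ[ℝ] EuclideanSpace ℝ (Fin (m + 1)),
      T (EuclideanSpace.single 0 ‖ζ‖) = ζ ∧ MeasurePreserving T := by
  have hn : ‖ζ‖ ≠ 0 := norm_ne_zero_iff.2 hζ
  obtain ⟨b, hb⟩ := Orthonormal.exists_orthonormalBasis_extension_of_card_eq (𝕜 := ℝ)
    (E := EuclideanSpace ℝ (Fin (m + 1))) (ι := Fin (m + 1)) (by simp)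
    (v := fun _ => ‖ζ‖⁻¹ • ζ) (s := {0}) (by
      refine ⟨fun i => ?_, fun i j hij => (hij (Subsingleton.elim i j)).elim⟩
      simp [norm_smul, hn])
  refine ⟨b.repr.symm, ?_, b.measurePreserving_repr_symm⟩
  have h1 : EuclideanSpace.single (0 : Fin (m + 1)) ‖ζ‖ =
      ‖ζ‖ • EuclideanSpace.single (0 : Fin (m + 1)) (1 : ℝ) := by
    ext i; simp
  rw [h1, map_smul, OrthonormalBasis.repr_symm_single, hb 0 rfl, smul_smul,
    mul_inv_cancel₀ hn, one_smul]

/-- The splitting `(u, w) ↦ u e₀ + w` of Euclidean space preserves volume. -/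
theorem measurePreserving_cons (m : ℕ) :
    MeasurePreserving (fun p : ℝ × EuclideanSpace ℝ (Fin m) =>
      WithLp.toLp 2 (Fin.cons p.1 p.2.ofLp : Fin (m + 1) → ℝ)) := by
  have h1 := (volume_preserving_piFinSuccAbove (fun _ : Fin (m + 1) => ℝ) 0).symm
  have h2 : MeasurePreserving (fun p : ℝ × EuclideanSpace ℝ (Fin m) => (p.1, p.2.ofLp))
      (volume.prod volume) (volume.prod volume) :=
    (MeasurePreserving.id volume).prod (PiLp.volume_preserving_ofLp (Fin m))
  have h3 := (PiLp.volume_preserving_toLp (Fin (m + 1))).comp (h1.comp h2)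
  convert! h3 using 1
  ext p i
  simp [MeasurableEquiv.piFinSuccAbove]

theorem norm_toLp_cons {m : ℕ} (u : ℝ) (w : EuclideanSpace ℝ (Fin m)) :
    ‖(WithLp.toLp 2 (Fin.cons u w.ofLp : Fin (m + 1) → ℝ) : EuclideanSpace ℝ (Fin (m + 1)))‖ =
      √(u ^ 2 + ‖w‖ ^ 2) := by
  rw [EuclideanSpace.norm_eq, EuclideanSpace.norm_sq_eq, Fin.sum_univ_succ]
  simp

theorem toLp_cons_add_single {m : ℕ} (u L : ℝ) (w : EuclideanSpace ℝ (Fin m)) :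
    (WithLp.toLp 2 (Fin.cons u w.ofLp : Fin (m + 1) → ℝ) : EuclideanSpace ℝ (Fin (m + 1))) +
      EuclideanSpace.single 0 L = WithLp.toLp 2 (Fin.cons (u + L) w.ofLp) := by
  ext i
  refine Fin.cases ?_ (fun i => ?_) i <;> simp

/-- After rotating `ζ` onto the first axis, Fubini over the transverse variable `w` applies the
slice bound with `v = ‖w‖²`. Slices with `‖w‖ > 1` are empty, so radius `2` is ample. -/
theorem volume_phaseSet_one_le {m : ℕ} (hm : 1 ≤ m) {ζ : EuclideanSpace ℝ (Fin (m + 1))}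
    (hζ : ζ ≠ 0) (a : ℝ) {h θ : ℝ} (hh : 0 ≤ h) (hθ : 0 ≤ θ) (hθ1 : θ ≤ 1) :
    volume (phaseSet ζ 1 a h) ≤ ENNReal.ofReal (2 * (h / ‖ζ‖) ^ θ) *
      ∫⁻ w in Metric.ball (0 : EuclideanSpace ℝ (Fin m)) 2,
        ENNReal.ofReal ((‖w‖ ^ 2) ^ (-θ)) := by
  have hL : 0 < ‖ζ‖ := norm_pos_iff.2 hζ
  obtain ⟨T, hT, hTm⟩ := exists_isometry_single_eq hζ
  have e1 : T ⁻¹' phaseSet ζ 1 a h = phaseSet (EuclideanSpace.single 0 ‖ζ‖) 1 a h := by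
    ext ξ
    have : T ξ + ζ = T (ξ + EuclideanSpace.single 0 ‖ζ‖) := by rw [map_add, hT]
    simp only [phaseSet, Set.preimage_ofPred_eq, Set.mem_ofPred_eq, this,
      LinearIsometryEquiv.norm_map]
  have hms := measurableSet_phaseSet (m := m + 1) (EuclideanSpace.single 0 ‖ζ‖) 1 a h
  rw [← hTm.measure_preimage (measurableSet_phaseSet ζ 1 a h).nullMeasurableSet, e1,
    ← (measurePreserving_cons m).measure_preimage hms.nullMeasurableSet, Measure.volume_eq_prod,
    Measure.prod_apply_symm ((measurePreserving_cons m).measurable hms),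
    ← lintegral_const_mul' _ _ ENNReal.ofReal_ne_top, ← lintegral_indicator measurableSet_ball]
  have : Nonempty (Fin m) := ⟨⟨0, hm⟩⟩
  have hae : ∀ᵐ w : EuclideanSpace ℝ (Fin m), w ≠ 0 := by
    simp [ae_iff, measure_singleton]
  refine lintegral_mono_ae ?_
  filter_upwards [hae] with w hw
  have e2 : (fun u : ℝ => (u, w)) ⁻¹' ((fun p : ℝ × EuclideanSpace ℝ (Fin m) =>
      WithLp.toLp 2 (Fin.cons p.1 p.2.ofLp : Fin (m + 1) → ℝ)) ⁻¹'
      phaseSet (EuclideanSpace.single 0 ‖ζ‖) 1 a h) = sliceSet ‖ζ‖ (‖w‖ ^ 2) a h := by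
    ext u
    simp only [phaseSet, sliceSet, Set.preimage_ofPred_eq, Set.mem_ofPred_eq,
      toLp_cons_add_single, norm_toLp_cons, Real.sqrt_le_one]
  rw [e2]
  by_cases hw2 : w ∈ Metric.ball (0 : EuclideanSpace ℝ (Fin m)) 2
  · rw [Set.indicator_of_mem hw2, ← ENNReal.ofReal_mul (by positivity)]
    exact volume_sliceSet_le_rpow a hL (by positivity) hh hθ hθ1
  · rw [Set.indicator_of_notMem hw2, sliceSet_eq_empty a, measure_empty]
    rw [mem_ball_zero_iff, not_lt] at hw2
    nlinarith

theorem lintegral_ball_rpow_lt_top {m : ℕ} {θ : ℝ} (hm : 1 ≤ m) (hθ : 2 * θ < m) :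
    ∫⁻ w in Metric.ball (0 : EuclideanSpace ℝ (Fin m)) 2,
        ENNReal.ofReal ((‖w‖ ^ 2) ^ (-θ)) < ⊤ := by
  have h := integrableOn_ball_of_norm_le_rpow (μ := (volume : Measure (EuclideanSpace ℝ (Fin m))))
    (f := fun w => (‖w‖ ^ 2) ^ (-θ)) (C := 1) (α := 2 * θ) (r := 2) (by simpa using hm)
    (by simpa using hθ) (Filter.Eventually.of_forall fun w => by
      rw [Real.norm_of_nonneg (by positivity), one_mul, ← Real.rpow_natCast,
        ← Real.rpow_mul (norm_nonneg _)]
      apply le_of_eq; congr 1; push_cast; ring)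
    (Measurable.aestronglyMeasurable ((measurable_norm.pow_const 2).pow_const _))
  exact h.lintegral_lt_top

/-- Dilation of the sets `phaseSet`. -/
theorem volume_phaseSet_smul {m : ℕ} (ζ : EuclideanSpace ℝ (Fin m)) {R : ℝ} (hR : 0 < R)
    (a h : ℝ) : volume (phaseSet ζ R a h) =
      ENNReal.ofReal (R ^ m) * volume (phaseSet (R⁻¹ • ζ) 1 (a / R) (h / R)) := by
  have e : phaseSet ζ R a h = R • phaseSet (R⁻¹ • ζ) 1 (a / R) (h / R) := by
    ext ξ
    rw [Set.mem_smul_set_iff_inv_smul_mem₀ hR.ne']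
    simp only [phaseSet, Set.mem_ofPred_eq, ← smul_add, norm_smul, norm_inv, Real.norm_eq_abs,
      abs_of_pos hR, inv_mul_le_iff₀ hR, mul_one, ← mul_sub, ← add_div, div_le_iff₀ hR,
      lt_div_iff₀ hR]
    rw [mul_comm R⁻¹, inv_mul_cancel_right₀ hR.ne']
  rw [e, Measure.addHaar_smul]
  simp [abs_of_pos hR]

/-- Dilation to the unit ball turns the width `1` into `1 / R` and the shift into `‖ζ‖ / R`. Their
ratio does not depend on `R`, so only the Jacobian `R ^ (m + 1)` appears. -/
theorem exists_volume_phaseSet_le {m : ℕ} (hm : 1 ≤ m) {θ : ℝ} (hθ : 0 ≤ θ) (hθ1 : θ ≤ 1)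
    (hθm : 2 * θ < m) : ∃ C : ℝ, 0 ≤ C ∧ ∀ (ζ : EuclideanSpace ℝ (Fin (m + 1))) (R a : ℝ),
      ζ ≠ 0 → 0 < R →
      volume (phaseSet ζ R a 1) ≤ ENNReal.ofReal (C * R ^ (m + 1) * ‖ζ‖ ^ (-θ)) := by
  have hfin := lintegral_ball_rpow_lt_top hm hθm
  set J := ∫⁻ w in Metric.ball (0 : EuclideanSpace ℝ (Fin m)) 2,
        ENNReal.ofReal ((‖w‖ ^ 2) ^ (-θ))
  refine ⟨2 * J.toReal, by positivity, fun ζ R a hζ hR => ?_⟩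
  rw [volume_phaseSet_smul ζ hR]
  refine (mul_le_mul_right (volume_phaseSet_one_le hm
    (smul_ne_zero (inv_ne_zero hR.ne') hζ) (a / R) (by positivity) hθ hθ1) _).trans ?_
  change _ * (_ * J) ≤ _
  rw [show J = ENNReal.ofReal J.toReal from (ENNReal.ofReal_toReal hfin.ne).symm, ← ENNReal.ofReal_mul (by positivity),
    ← ENNReal.ofReal_mul (by positivity)]
  refine ENNReal.ofReal_le_ofReal (le_of_eq ?_)
  have : 1 / R / ‖R⁻¹ • ζ‖ = ‖ζ‖⁻¹ := by
    rw [norm_smul, norm_inv, Real.norm_of_nonneg hR.le]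
    field_simp
  rw [this, Real.inv_rpow (norm_nonneg _), ← Real.rpow_neg (norm_nonneg _),
    ENNReal.toReal_ofReal ENNReal.toReal_nonneg]
  ring


/-! ### Choice of exponents and summation over the windows. -/

/-- The origin of the threshold. The interpolation needs `θ ≤ 1` and `θ < (d - 1) / 2`, and the
final power of `R` is `d + 1 - θ + ε`. Taking `θ` near `1 / 2` for `d = 2` gives `4s > 5/2`; taking
`θ` near `1` for `d ≥ 3` gives `4s > d`. -/
theorem exists_phase_exponents {d : ℕ} (hd : 2 ≤ d) {s : ℝ} (hs : max ((d : ℝ) / 4) (5 / 8) < s) :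
    ∃ θ ε : ℝ, 0 ≤ θ ∧ θ ≤ 1 ∧ 2 * θ < d - 1 ∧ 0 < ε ∧ d + (1 + ε - θ) ≤ 4 * s := by
  obtain ⟨h1, h2⟩ := max_lt_iff.1 hs
  rcases hd.eq_or_lt with rfl | hd3
  · push_cast at *
    have he : 0 < min ((4 * s - 5 / 2) / 2) (1 / 4) := lt_min (by linarith) (by norm_num)
    have e1 := min_le_left ((4 * s - 5 / 2) / 2) (1 / 4)
    have e2 := min_le_right ((4 * s - 5 / 2) / 2) (1 / 4)
    exact ⟨1 / 2 - min ((4 * s - 5 / 2) / 2) (1 / 4), _, by linarith, by linarith, by linarith, he,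
      by linarith⟩
  · have hd' : (3 : ℝ) ≤ d := by exact_mod_cast hd3
    have he : 0 < min ((4 * s - d) / 2) (1 / 4) := lt_min (by linarith) (by norm_num)
    have e1 := min_le_left ((4 * s - d) / 2) (1 / 4)
    have e2 := min_le_right ((4 * s - d) / 2) (1 / 4)
    exact ⟨1 - min ((4 * s - d) / 2) (1 / 4), _, by linarith, by linarith, by linarith, he,
      by linarith⟩

/-- The phase is at most `‖ζ‖` and at most `R` in absolute value. The windows `n = 0, -1` contain
arbitrarily small phases and must be excluded; for `n ≤ -2` the phase is only known to exceed `|n| -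
1 ≥ |n| / 2` in size, hence the factor `2`. -/
theorem abs_le_of_mem_phaseSet {m : ℕ} {ζ ξ : EuclideanSpace ℝ (Fin m)} {R : ℝ} {n : ℤ}
    (hξ : ξ ∈ phaseSet ζ R n 1) (h0 : n ≠ 0) (h1 : n ≠ -1) :
    |(n : ℝ)| ≤ 2 * ‖ζ‖ ∧ |(n : ℝ)| ≤ 2 * R := by
  obtain ⟨a1, a2, a3, a4⟩ := hξ
  have b1 := norm_nonneg ξ
  have b2 := norm_nonneg (ξ + ζ)
  have b3 := norm_add_le ξ ζ
  have b4 : ‖ξ‖ ≤ ‖ξ + ζ‖ + ‖ζ‖ := by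
    simpa using norm_sub_le (ξ + ζ) ζ
  rcases lt_or_ge n 0 with hn | hn
  · have : (n : ℝ) ≤ -2 := by exact_mod_cast (by omega : n ≤ -2)
    rw [abs_of_nonpos (by linarith)]
    constructor <;> linarith
  · have : (1 : ℝ) ≤ n := by exact_mod_cast (by omega : 1 ≤ n)
    rw [abs_of_nonneg (by linarith)]
    constructor <;> linarith

/-- The sets `phaseSet ζ R n 1`, `n ∈ ℤ`, have summable volumes, uniformly in `ζ`. -/
theorem exists_summable_volume_phaseSet_le {d : ℕ} (hd : 2 ≤ d) {s : ℝ}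
    (hs : max ((d : ℝ) / 4) (5 / 8) < s) :
    ∃ w : ℤ → ℝ, Summable w ∧ (∀ n, 0 ≤ w n) ∧
      ∀ (ζ : EuclideanSpace ℝ (Fin d)) (R : ℝ) (n : ℤ), 1 ≤ R →
        volume (phaseSet ζ R n 1) ≤ ENNReal.ofReal (R ^ (4 * s) * w n) := by
  obtain ⟨θ, ε, hθ, hθ1, hθd, hε, hexp⟩ := exists_phase_exponents hd hs
  obtain ⟨m, rfl⟩ : ∃ m, d = m + 1 := ⟨d - 1, by omega⟩
  obtain ⟨C, hC, hvol⟩ := exists_volume_phaseSet_le (m := m) (by omega) hθ hθ1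
    (by push_cast at hθd; linarith)
  have hds : ((m + 1 : ℕ) : ℝ) ≤ 4 * s := by linarith
  set B : ℝ := (volume (Metric.closedBall (0 : EuclideanSpace ℝ (Fin (m + 1))) 1)).toReal with hB
  set A : ℝ := C * (2 ^ θ * 2 ^ (1 + ε - θ)) with hA
  refine ⟨fun n => A * |(n : ℝ)| ^ (-(1 + ε)) + if n ∈ ({0, -1} : Finset ℤ) then B else 0,
    ((Real.summable_abs_int_rpow (by linarith)).mul_left A).add
      (summable_of_ne_finset_zero (s := {0, -1}) fun n hn => by simp [hn]),
    fun n => by positivity, fun ζ R n hR => ?_⟩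
  have hR0 : 0 < R := by linarith
  -- For these two windows the volume of the whole ball suffices, because `d ≤ 4s`.
  by_cases hn : n ∈ ({0, -1} : Finset ℤ)
  · have h1 : volume (phaseSet ζ R n 1) ≤ ENNReal.ofReal (R ^ (m + 1) * B) := by
      refine (measure_mono (t := Metric.closedBall 0 R) fun ξ hξ => by simpa using hξ.1).trans ?_
      rw [Measure.addHaar_closedBall _ _ hR0.le, ENNReal.ofReal_mul (by positivity), hB,
        ENNReal.ofReal_toReal measure_closedBall_lt_top.ne,
        Measure.addHaar_closedBall_eq_addHaar_ball]
      simp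
    refine h1.trans (ENNReal.ofReal_le_ofReal ?_)
    beta_reduce
    rw [if_pos hn, ← Real.rpow_natCast]
    have := Real.rpow_le_rpow_of_exponent_le hR hds
    have hB0 : 0 ≤ B := ENNReal.toReal_nonneg
    have hA' : 0 ≤ A * |(n : ℝ)| ^ (-(1 + ε)) := by positivity
    gcongr
    linarith
  · beta_reduce
    rw [if_neg hn, add_zero]
    simp only [Finset.mem_insert, Finset.mem_singleton, not_or] at hn
    rcases (phaseSet ζ R (n : ℝ) 1).eq_empty_or_nonempty with he | ⟨ξ, hξ⟩
    · rw [he, measure_empty]; exact zero_le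
    obtain ⟨b1, b2⟩ := abs_le_of_mem_phaseSet hξ hn.1 hn.2
    have hnpos : 0 < |(n : ℝ)| := by simpa using hn.1
    have hζ : 0 < ‖ζ‖ := by linarith
    refine (hvol ζ R n (norm_pos_iff.1 hζ) hR0).trans (ENNReal.ofReal_le_ofReal ?_)
    have c1 : ‖ζ‖ ^ (-θ) ≤ (|(n : ℝ)| / 2) ^ (-θ) :=
      Real.rpow_le_rpow_of_nonpos (by positivity) (by linarith) (by linarith)
    -- The decay `|n| ^ (-θ)` alone is not summable; the missing power `1 + ε - θ` of `|n|` is paid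
    -- for with `R`, using `|n| ≤ 2R`.
    have c2 : (|(n : ℝ)| / 2) ^ (-θ) =
        2 ^ θ * (|(n : ℝ)| ^ (-(1 + ε)) * |(n : ℝ)| ^ (1 + ε - θ)) := by
      rw [← Real.rpow_add hnpos, Real.div_rpow hnpos.le (by norm_num),
        Real.rpow_neg (by norm_num : (0 : ℝ) ≤ 2), div_inv_eq_mul, mul_comm]
      congr 2
      ring
    have c3 : |(n : ℝ)| ^ (1 + ε - θ) ≤ 2 ^ (1 + ε - θ) * R ^ (1 + ε - θ) := by
      rw [← Real.mul_rpow (by norm_num) hR0.le]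
      exact Real.rpow_le_rpow hnpos.le b2 (by linarith)
    have c4 : R ^ (m + 1) * R ^ (1 + ε - θ) ≤ R ^ (4 * s) := by
      rw [← Real.rpow_natCast, ← Real.rpow_add hR0]
      exact Real.rpow_le_rpow_of_exponent_le hR hexp
    calc C * R ^ (m + 1) * ‖ζ‖ ^ (-θ)
        ≤ C * R ^ (m + 1) * (2 ^ θ * (|(n : ℝ)| ^ (-(1 + ε)) *
          (2 ^ (1 + ε - θ) * R ^ (1 + ε - θ)))) := by
          rw [c2] at c1
          gcongr
          exact c1.trans (by gcongr)
      _ = (R ^ (m + 1) * R ^ (1 + ε - θ)) * (A * |(n : ℝ)| ^ (-(1 + ε))) := by rw [hA]; ring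
      _ ≤ _ := by gcongr


/-! ### Fourier transform of a measure carried by a graph. -/

theorem sq_lintegral_mul_le {α : Type*} [MeasurableSpace α] {μ : Measure α} {f g : α → ℝ≥0∞}
    (hf : AEMeasurable f μ) (hg : AEMeasurable g μ) :
    (∫⁻ a, f a * g a ∂μ) ^ 2 ≤ (∫⁻ a, f a ^ 2 ∂μ) * ∫⁻ a, g a ^ 2 ∂μ := by
  have h := ENNReal.lintegral_mul_le_Lp_mul_Lq μ Real.HolderConjugate.two_two hf hg
  have h2 := pow_le_pow_left' h 2
  simp only [Pi.mul_apply, mul_pow, ENNReal.rpow_ofNat] at h2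
  refine h2.trans (le_of_eq ?_)
  simp only [← ENNReal.rpow_natCast, ← ENNReal.rpow_mul]
  norm_num

theorem enorm_add_sq_le (a b : ℂ) : ‖a + b‖ₑ ^ 2 ≤ 2 * ‖a‖ₑ ^ 2 + 2 * ‖b‖ₑ ^ 2 := by
  have h : ‖a + b‖ ^ 2 ≤ 2 * ‖a‖ ^ 2 + 2 * ‖b‖ ^ 2 := by
    nlinarith [norm_add_le a b, norm_nonneg (a + b), sq_nonneg (‖a‖ - ‖b‖)]
  have := ENNReal.ofReal_le_ofReal h
  rw [ENNReal.ofReal_add (by positivity) (by positivity), ENNReal.ofReal_mul (by norm_num),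
    ENNReal.ofReal_mul (by norm_num)] at this
  simpa [ENNReal.ofReal_pow] using this

/-- The space-time Fourier transform of the measure `g(x) δ(t - T(x))`. -/
noncomputable def graphFourier {d : ℕ} (g : EuclideanSpace ℝ (Fin d) → ℂ)
    (T : EuclideanSpace ℝ (Fin d) → ℝ) (τ : ℝ) (ζ : EuclideanSpace ℝ (Fin d)) : ℂ :=
  ∫ x, g x * Complex.exp (((-(2 * Real.pi * (inner ℝ x ζ + T x * τ)) : ℝ) : ℂ) * Complex.I)

section

variable {d : ℕ} {g : EuclideanSpace ℝ (Fin d) → ℂ} {T : EuclideanSpace ℝ (Fin d) → ℝ} {K : ℝ}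

theorem integrable_of_bound_of_support (hg : Measurable g) (hK : ∀ x, ‖g x‖ ≤ K)
    (hs : ∀ x, x ∉ Metric.ball 0 1 → g x = 0) : Integrable g := by
  have h : IntegrableOn g (Metric.ball 0 1) :=
    Measure.integrableOn_of_bounded measure_ball_lt_top.ne hg.aestronglyMeasurable
      (Filter.Eventually.of_forall hK)
  refine (integrableOn_iff_integrable_of_support_subset fun x hx => ?_).1 h
  by_contra hx'
  exact hx (hs x hx')

theorem memLp_of_bound_of_support (hg : Measurable g) (hK : ∀ x, ‖g x‖ ≤ K)
    (hs : ∀ x, x ∉ Metric.ball 0 1 → g x = 0) : MemLp g 2 :=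
  (memLp_two_iff_integrable_sq_norm hg.aestronglyMeasurable).2 <| by
    refine ((integrable_of_bound_of_support hg hK hs).norm.const_mul K).mono'
      (by fun_prop) (Filter.Eventually.of_forall fun x => ?_)
    rw [Real.norm_of_nonneg (by positivity), sq]
    exact mul_le_mul_of_nonneg_right (hK x) (norm_nonneg _)

/-- For fixed `τ` the factor `exp(-2πi T(x) τ)` is unimodular, so this is Plancherel in `x` alone,
uniform in `τ` and `T`. -/
theorem lintegral_graphFourier_sq (hg : Measurable g) (hT : Measurable T) (hK : ∀ x, ‖g x‖ ≤ K)
    (hs : ∀ x, x ∉ Metric.ball 0 1 → g x = 0) (τ : ℝ) :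
    ∫⁻ ζ, ‖graphFourier g T τ ζ‖ₑ ^ 2 = ∫⁻ x, ‖g x‖ₑ ^ 2 := by
  set G : EuclideanSpace ℝ (Fin d) → ℂ :=
    fun x => g x * Complex.exp (((-(2 * Real.pi * (T x * τ)) : ℝ) : ℂ) * Complex.I) with hG
  have hGm : Measurable G := by fun_prop
  have hGn : ∀ x, ‖G x‖ = ‖g x‖ := fun x => by
    rw [hG, norm_mul, Complex.norm_exp_ofReal_mul_I, mul_one]
  have hGK : ∀ x, ‖G x‖ ≤ K := fun x => (hGn x).trans_le (hK x)
  have hGs : ∀ x, x ∉ Metric.ball 0 1 → G x = 0 := fun x hx => by simp [hG, hs x hx]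
  have e : ∀ ζ, graphFourier g T τ ζ = 𝓕 G ζ := fun ζ => by
    rw [graphFourier, Real.fourier_eq']
    refine integral_congr_ae (Filter.Eventually.of_forall fun x => ?_)
    simp only [hG, smul_eq_mul]
    rw [mul_left_comm, ← Complex.exp_add]
    congr 2
    push_cast
    ring
  have e2 : ∀ x, ‖g x‖ₑ = ‖G x‖ₑ := fun x => by rw [← ofReal_norm, ← hGn, ofReal_norm]
  simp_rw [e, e2]
  exact lintegral_enorm_fourier_sq (integrable_of_bound_of_support hGm hGK hGs)
    (memLp_of_bound_of_support hGm hGK hGs)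

theorem measurable_graphFourier (hg : Measurable g) (hT : Measurable T) :
    Measurable fun p : ℝ × EuclideanSpace ℝ (Fin d) => graphFourier g T p.1 p.2 := by
  refine (StronglyMeasurable.integral_prod_right (f := fun (p : ℝ × EuclideanSpace ℝ (Fin d)) x =>
    g x * Complex.exp (((-(2 * Real.pi * (inner ℝ x p.2 + T x * p.1)) : ℝ) : ℂ) * Complex.I))
    (Measurable.stronglyMeasurable ?_)).measurable
  simp only [Function.uncurry_def]
  have : Measurable fun a : (ℝ × EuclideanSpace ℝ (Fin d)) × EuclideanSpace ℝ (Fin d) =>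
    inner ℝ a.2 a.1.2 := by fun_prop
  fun_prop

theorem exp_ofReal_mul_I_sub_one (a θ : ℝ) :
    Complex.exp (((-(a * θ) : ℝ) : ℂ) * Complex.I) - 1 =
      ∫ u in (0 : ℝ)..θ, -Complex.I * a * Complex.exp (((-(a * u) : ℝ) : ℂ) * Complex.I) := by
  have hd : ∀ u : ℝ, HasDerivAt (fun u : ℝ => Complex.exp (((-(a * u) : ℝ) : ℂ) * Complex.I))
      (-Complex.I * a * Complex.exp (((-(a * u) : ℝ) : ℂ) * Complex.I)) u := fun u => by
    have h1 : HasDerivAt (fun u : ℝ => ((-(a * u) : ℝ) : ℂ) * Complex.I)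
        (((-(a * 1) : ℝ) : ℂ) * Complex.I) u :=
      ((((hasDerivAt_id u).const_mul a).neg).ofReal_comp).mul_const _
    convert! h1.cexp using 1
    push_cast
    ring
  rw [intervalIntegral.integral_eq_sub_of_hasDerivAt (fun u _ => hd u)
    (Continuous.intervalIntegrable (by fun_prop) _ _)]
  simp

/-- The time-frequency derivative formula for `graphFourier` in integrated form. -/
theorem graphFourier_add (hg : Measurable g) (hT : Measurable T) (hK : ∀ x, ‖g x‖ ≤ K)
    (hs : ∀ x, x ∉ Metric.ball 0 1 → g x = 0) (hT1 : ∀ x, |T x| ≤ 1) (τ : ℝ) {θ : ℝ} (hθ : 0 ≤ θ)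
    (ζ : EuclideanSpace ℝ (Fin d)) :
    graphFourier g T (τ + θ) ζ = graphFourier g T τ ζ +
      ∫ u in (0 : ℝ)..θ, graphFourier (fun x => -Complex.I * (2 * Real.pi * T x : ℝ) * g x) T
        (τ + u) ζ := by
  have hgi := integrable_of_bound_of_support hg hK hs
  have hint : ∀ τ, Integrable fun x => g x *
      Complex.exp (((-(2 * Real.pi * (inner ℝ x ζ + T x * τ)) : ℝ) : ℂ) * Complex.I) := fun τ =>
    hgi.norm.mono' (by fun_prop) (Filter.Eventually.of_forall fun x => by
      rw [norm_mul, Complex.norm_exp_ofReal_mul_I, mul_one])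
  rw [← sub_eq_iff_eq_add']
  unfold graphFourier
  rw [← integral_sub (hint _) (hint _), intervalIntegral_integral_swap]
  · refine integral_congr_ae (Filter.Eventually.of_forall fun x => ?_)
    have h := exp_ofReal_mul_I_sub_one (2 * Real.pi * T x) θ
    have h2 := congrArg (fun z => g x * Complex.exp (((-(2 * Real.pi * (inner ℝ x ζ + T x * τ)) : ℝ)
      : ℂ) * Complex.I) * z) h
    simp only [mul_sub, mul_one, ← intervalIntegral.integral_const_mul] at h2
    convert! h2 using 1
    · rw [mul_assoc, ← Complex.exp_add]
      push_cast
      ring_nf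
    · refine intervalIntegral.integral_congr fun u _ => ?_
      simp only
      rw [show ∀ a b c d e : ℂ, a * b * (c * d * e) = c * d * a * (b * e) by intros; ring,
        ← Complex.exp_add]
      congr 2
      push_cast
      ring
  · rw [Set.uIoc_of_le hθ]
    have hb : Integrable (fun p : ℝ × EuclideanSpace ℝ (Fin d) => 2 * Real.pi * ‖g p.2‖)
        ((volume.restrict (Set.Ioc 0 θ)).prod volume) :=
      (hgi.norm.const_mul _).comp_snd _
    refine hb.mono' ?_ (Filter.Eventually.of_forall fun p => ?_)
    · simp only [Function.uncurry_def]
      have : Measurable fun p : ℝ × EuclideanSpace ℝ (Fin d) => inner ℝ p.2 ζ := by fun_prop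
      exact Measurable.aestronglyMeasurable (by fun_prop)
    · simp only [Function.uncurry_def]
      rw [norm_mul, Complex.norm_exp_ofReal_mul_I, mul_one, norm_mul, norm_mul, norm_neg,
        Complex.norm_I, one_mul, Complex.norm_real, norm_mul, Real.norm_of_nonneg (by positivity),
        Real.norm_eq_abs]
      exact mul_le_mul_of_nonneg_right (mul_le_of_le_one_right (by positivity) (hT1 p.2))
        (norm_nonneg _)

/-- A Sobolev-type bound in `τ`: differentiating in `τ` only multiplies `g` by the bounded factor
`-2πi T`. The right side is free of `θ`, which permits a supremum over the window. -/
theorem enorm_graphFourier_add_sq_le (hg : Measurable g) (hT : Measurable T) (hK : ∀ x, ‖g x‖ ≤ K)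
    (hs : ∀ x, x ∉ Metric.ball 0 1 → g x = 0) (hT1 : ∀ x, |T x| ≤ 1) (τ : ℝ) {θ : ℝ} (hθ : 0 ≤ θ)
    (hθ1 : θ ≤ 1) (ζ : EuclideanSpace ℝ (Fin d)) :
    ‖graphFourier g T (τ + θ) ζ‖ₑ ^ 2 ≤ 2 * ‖graphFourier g T τ ζ‖ₑ ^ 2 +
      2 * ∫⁻ u in Set.Ioc (0 : ℝ) 1, ‖graphFourier
        (fun x => -Complex.I * (2 * Real.pi * T x : ℝ) * g x) T (τ + u) ζ‖ₑ ^ 2 := by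
  rw [graphFourier_add hg hT hK hs hT1 τ hθ ζ]
  refine (enorm_add_sq_le _ _).trans ?_
  gcongr
  have hm : Measurable fun u : ℝ => graphFourier
        (fun x => -Complex.I * (2 * Real.pi * T x : ℝ) * g x) T (τ + u) ζ :=
    (measurable_graphFourier (by fun_prop) hT).comp (f := fun u : ℝ => (τ + u, ζ)) (by fun_prop)
  rw [intervalIntegral.integral_of_le hθ]
  refine (pow_le_pow_left' (enorm_integral_le_lintegral_enorm _) 2).trans ?_
  refine (pow_le_pow_left' (lintegral_mono_set (Set.Ioc_subset_Ioc_right hθ1)) 2).trans ?_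
  have := sq_lintegral_mul_le (μ := volume.restrict (Set.Ioc (0 : ℝ) 1)) hm.enorm.aemeasurable
    (aemeasurable_const (b := (1 : ℝ≥0∞)))
  simpa using this

end


/-! ### Window majorants and the Hilbert–Schmidt integral. -/

/-- A majorant of `‖graphFourier g T (τ + θ) ζ‖ ^ 2`, uniformly in `θ ∈ [0, 1]`. -/
noncomputable def windowMajorant {d : ℕ} (g : EuclideanSpace ℝ (Fin d) → ℂ)
    (T : EuclideanSpace ℝ (Fin d) → ℝ) (τ : ℝ) (ζ : EuclideanSpace ℝ (Fin d)) : ℝ≥0∞ :=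
  2 * ‖graphFourier g T τ ζ‖ₑ ^ 2 +
    2 * ∫⁻ u in Set.Ioc (0 : ℝ) 1, ‖graphFourier
        (fun x => -Complex.I * (2 * Real.pi * T x : ℝ) * g x) T (τ + u) ζ‖ₑ ^ 2

section

variable {d : ℕ} {g : EuclideanSpace ℝ (Fin d) → ℂ} {T : EuclideanSpace ℝ (Fin d) → ℝ} {K : ℝ}

theorem measurable_windowMajorant (hg : Measurable g) (hT : Measurable T) (τ : ℝ) :
    Measurable (windowMajorant g T τ) := by
  have h1 : Measurable (graphFourier g T τ) :=
    (measurable_graphFourier hg hT).comp (f := fun ζ => (τ, ζ)) (by fun_prop)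
  have h2 : Measurable fun p : EuclideanSpace ℝ (Fin d) × ℝ => graphFourier
      (fun x => -Complex.I * (2 * Real.pi * T x : ℝ) * g x) T (τ + p.2) p.1 :=
    (measurable_graphFourier (by fun_prop) hT).comp
      (f := fun p : EuclideanSpace ℝ (Fin d) × ℝ => (τ + p.2, p.1)) (by fun_prop)
  exact ((h1.enorm.pow_const 2).const_mul 2).add
    (((h2.enorm.pow_const 2).lintegral_prod_right').const_mul 2)

theorem lintegral_windowMajorant_le (hg : Measurable g) (hT : Measurable T) (hK : ∀ x, ‖g x‖ ≤ K)
    (hs : ∀ x, x ∉ Metric.ball 0 1 → g x = 0) (hT1 : ∀ x, |T x| ≤ 1) (τ : ℝ) :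
    ∫⁻ ζ, windowMajorant g T τ ζ ≤
      ENNReal.ofReal (2 + 2 * (2 * Real.pi) ^ 2) * ∫⁻ x, ‖g x‖ₑ ^ 2 := by
  set g₁ : EuclideanSpace ℝ (Fin d) → ℂ :=
    fun x => -Complex.I * (2 * Real.pi * T x : ℝ) * g x with hg₁
  have hm₁ : Measurable g₁ := by fun_prop
  have hn : ∀ x, ‖g₁ x‖ ≤ 2 * Real.pi * ‖g x‖ := fun x => by
    rw [hg₁, norm_mul, norm_mul, norm_neg, Complex.norm_I, one_mul, Complex.norm_real, norm_mul,
      Real.norm_of_nonneg (by positivity), Real.norm_eq_abs]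
    exact mul_le_mul_of_nonneg_right (mul_le_of_le_one_right (by positivity) (hT1 x))
      (norm_nonneg _)
  have hK₁ : ∀ x, ‖g₁ x‖ ≤ 2 * Real.pi * K := fun x =>
    (hn x).trans (mul_le_mul_of_nonneg_left (hK x) (by positivity))
  have hs₁ : ∀ x, x ∉ Metric.ball 0 1 → g₁ x = 0 := fun x hx => by simp [hg₁, hs x hx]
  have h1 : Measurable (graphFourier g T τ) :=
    (measurable_graphFourier hg hT).comp (f := fun ζ => (τ, ζ)) (by fun_prop)
  have h2 : Measurable fun p : EuclideanSpace ℝ (Fin d) × ℝ => graphFourier g₁ T (τ + p.2) p.1 :=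
    (measurable_graphFourier hm₁ hT).comp
      (f := fun p : EuclideanSpace ℝ (Fin d) × ℝ => (τ + p.2, p.1)) (by fun_prop)
  have hn2 : ∫⁻ x, ‖g₁ x‖ₑ ^ 2 ≤ ENNReal.ofReal ((2 * Real.pi) ^ 2) * ∫⁻ x, ‖g x‖ₑ ^ 2 := by
    rw [← lintegral_const_mul _ (hg.enorm.pow_const 2)]
    refine lintegral_mono fun x => ?_
    rw [← ofReal_norm, ← ofReal_norm, ← ENNReal.ofReal_pow (norm_nonneg _),
      ← ENNReal.ofReal_pow (norm_nonneg _), ← ENNReal.ofReal_mul (by positivity), ← mul_pow]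
    exact ENNReal.ofReal_le_ofReal (pow_le_pow_left₀ (norm_nonneg _) (hn x) 2)
  unfold windowMajorant
  rw [lintegral_add_left ((h1.enorm.pow_const 2).const_mul 2),
    lintegral_const_mul _ (h1.enorm.pow_const 2),
    lintegral_const_mul _ (h2.enorm.pow_const 2).lintegral_prod_right',
    lintegral_graphFourier_sq hg hT hK hs,
    lintegral_lintegral_swap (h2.enorm.pow_const 2).aemeasurable]
  simp_rw [lintegral_graphFourier_sq hm₁ hT hK₁ hs₁]
  rw [lintegral_const, Measure.restrict_apply_univ, Real.volume_Ioc, sub_zero, ENNReal.ofReal_one,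
    mul_one, ENNReal.ofReal_add (by norm_num) (by positivity), ENNReal.ofReal_mul (by norm_num),
    add_mul, mul_assoc, ENNReal.ofReal_ofNat]
  gcongr

/-- On window `n` the integrand is dominated by a function of `ζ = ξ - η` only, so integrating in
`η` first produces the volume of `phaseSet ζ R n 1`. The volumes are bounded uniformly in `ζ` and
summably in `n`. -/
theorem exists_lintegral_graphFourier_le {d : ℕ} (hd : 2 ≤ d) {s : ℝ}
    (hs : max ((d : ℝ) / 4) (5 / 8) < s) :
    ∃ C : ℝ, 0 ≤ C ∧ ∀ (g : EuclideanSpace ℝ (Fin d) → ℂ) (T : EuclideanSpace ℝ (Fin d) → ℝ)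
      (K R : ℝ), Measurable g → Measurable T → (∀ x, ‖g x‖ ≤ K) →
      (∀ x, x ∉ Metric.ball 0 1 → g x = 0) → (∀ x, |T x| ≤ 1) → 1 ≤ R →
      ∫⁻ η in Metric.closedBall 0 R, ∫⁻ ξ in Metric.closedBall 0 R,
        ‖graphFourier g T (‖ξ‖ - ‖η‖) (ξ - η)‖ₑ ^ 2 ≤
          ENNReal.ofReal (C * R ^ (4 * s)) * ∫⁻ x, ‖g x‖ₑ ^ 2 := by
  obtain ⟨w, hw, hw0, hvol⟩ := exists_summable_volume_phaseSet_le hd hs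
  refine ⟨(∑' n, w n) * (2 + 2 * (2 * Real.pi) ^ 2),
    mul_nonneg (tsum_nonneg hw0) (by positivity), fun g T K R hg hT hK hgs hT1 hR => ?_⟩
  have hH := fun n : ℤ => measurable_windowMajorant hg hT n
  have hset : ∀ n : ℤ, MeasurableSet {p : EuclideanSpace ℝ (Fin d) × EuclideanSpace ℝ (Fin d) |
      p.1 ∈ phaseSet p.2 R n 1} := fun n => by
    have h1 : Measurable fun p : EuclideanSpace ℝ (Fin d) × EuclideanSpace ℝ (Fin d) => ‖p.1‖ := by
      fun_prop
    have h2 : Measurable fun p : EuclideanSpace ℝ (Fin d) × EuclideanSpace ℝ (Fin d) =>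
      ‖p.1 + p.2‖ := by fun_prop
    exact (measurableSet_le h1 measurable_const).inter
      ((measurableSet_le h2 measurable_const).inter
      ((measurableSet_le measurable_const (h2.sub h1)).inter
      (measurableSet_lt (h2.sub h1) measurable_const)))
  have hFm : ∀ n : ℤ, Measurable fun p : EuclideanSpace ℝ (Fin d) × EuclideanSpace ℝ (Fin d) =>
      (phaseSet p.2 R n 1).indicator (fun _ => windowMajorant g T n p.2) p.1 := fun n =>
    ((hH n).comp measurable_snd).indicator (hset n)
  calc ∫⁻ η in Metric.closedBall 0 R, ∫⁻ ξ in Metric.closedBall 0 R,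
        ‖graphFourier g T (‖ξ‖ - ‖η‖) (ξ - η)‖ₑ ^ 2
      ≤ ∫⁻ η, ∫⁻ ζ, ∑' n : ℤ,
          (phaseSet ζ R n 1).indicator (fun _ => windowMajorant g T n ζ) η := by
        rw [← lintegral_indicator Metric.isClosed_closedBall.measurableSet]
        refine lintegral_mono fun η => ?_
        by_cases hη : η ∈ Metric.closedBall (0 : EuclideanSpace ℝ (Fin d)) R
        swap
        · rw [Set.indicator_of_notMem hη]; exact zero_le
        rw [Set.indicator_of_mem hη, ← lintegral_indicator Metric.isClosed_closedBall.measurableSet,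
          ← lintegral_add_left_eq_self _ η]
        refine lintegral_mono fun ζ => ?_
        by_cases hζ : η + ζ ∈ Metric.closedBall (0 : EuclideanSpace ℝ (Fin d)) R
        swap
        · rw [Set.indicator_of_notMem hζ]; exact zero_le
        rw [Set.indicator_of_mem hζ, add_sub_cancel_left]
        -- Only the window containing the phase is kept; its fractional part is the displacement
        -- inside that window.
        refine le_trans ?_ (ENNReal.le_tsum ⌊‖η + ζ‖ - ‖η‖⌋)
        rw [Set.indicator_of_mem]
        · have := enorm_graphFourier_add_sq_le hg hT hK hgs hT1 (⌊‖η + ζ‖ - ‖η‖⌋ : ℝ)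
            (Int.fract_nonneg (‖η + ζ‖ - ‖η‖)) (Int.fract_lt_one _).le ζ
          rwa [Int.floor_add_fract] at this
        · exact ⟨by simpa using hη, by simpa using hζ, Int.floor_le _, Int.lt_floor_add_one _⟩
    _ = ∑' n : ℤ, ∫⁻ ζ, windowMajorant g T n ζ * volume (phaseSet ζ R n 1) := by
        rw [lintegral_lintegral_swap (Measurable.tsum hFm).aemeasurable]
        have hmul : ∀ n : ℤ, Measurable fun ζ : EuclideanSpace ℝ (Fin d) =>
            windowMajorant g T n ζ * volume (phaseSet ζ R n 1) := fun n =>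
          (hH n).mul (measurable_measure_prodMk_right (hset n))
        rw [← lintegral_tsum fun n => (hmul n).aemeasurable]
        refine lintegral_congr fun ζ => ?_
        rw [lintegral_tsum fun n : ℤ => (measurable_const.indicator
          (measurableSet_phaseSet ζ R (n : ℝ) 1)).aemeasurable]
        refine tsum_congr fun n => ?_
        rw [lintegral_indicator_const (measurableSet_phaseSet ζ R n 1)]
    _ ≤ ∑' n : ℤ, ENNReal.ofReal (R ^ (4 * s) * w n) *
          (ENNReal.ofReal (2 + 2 * (2 * Real.pi) ^ 2) * ∫⁻ x, ‖g x‖ₑ ^ 2) := by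
        refine ENNReal.tsum_le_tsum fun n => ?_
        refine (lintegral_mono fun ζ => mul_le_mul_right (hvol ζ R n hR) _).trans ?_
        rw [lintegral_mul_const _ (hH n), mul_comm]
        gcongr
        exact lintegral_windowMajorant_le hg hT hK hgs hT1 n
    _ = _ := by
        rw [ENNReal.tsum_mul_right, ← ENNReal.ofReal_tsum_of_nonneg
          (fun n => mul_nonneg (by positivity) (hw0 n)) (hw.mul_left _), tsum_mul_left, ← mul_assoc,
          ← ENNReal.ofReal_mul (mul_nonneg (by positivity) (tsum_nonneg hw0))]
        congr 2
        ring

end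


/-! ### Bessel's inequality and Gram kernels. -/

/-- Bessel's inequality in integral form. -/
theorem tsum_enorm_integral_mul_sq_le {d : ℕ} {ι : Type*} {u : ι → L2 d} (hu : Orthonormal ℂ u)
    {h : EuclideanSpace ℝ (Fin d) → ℂ} (hm : AEStronglyMeasurable h) :
    ∑' j, ‖∫ ξ, h ξ * u j ξ‖ₑ ^ 2 ≤ ∫⁻ ξ, ‖h ξ‖ₑ ^ 2 := by
  by_cases hfin : ∫⁻ ξ, ‖h ξ‖ₑ ^ 2 = ⊤
  · rw [hfin]; exact le_top
  have hsq := eLpNorm_nnreal_pow_eq_lintegral (p := 2) (f := h) (μ := volume) (by norm_num)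
  simp only [NNReal.coe_ofNat, ENNReal.coe_ofNat, ENNReal.rpow_ofNat] at hsq
  have hL : MemLp h 2 := ⟨hm, by
    rw [lt_top_iff_ne_top]
    intro h0
    rw [h0] at hsq
    exact hfin (by rw [← hsq]; simp)⟩
  have hL' : MemLp (fun ξ => conj (h ξ)) 2 := hL.star
  have hin : ∀ j, inner ℂ (hL'.toLp _) (u j) = ∫ ξ, h ξ * u j ξ := fun j => by
    rw [L2.inner_def]
    refine integral_congr_ae ?_
    filter_upwards [hL'.coeFn_toLp] with ξ hξ
    rw [hξ]
    simp [mul_comm]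
  have hnorm : ‖hL'.toLp _‖ₑ ^ 2 = ∫⁻ ξ, ‖h ξ‖ₑ ^ 2 := by
    rw [← hsq, Lp.enorm_def, eLpNorm_congr_ae hL'.coeFn_toLp]
    congr 1
    exact eLpNorm_congr_norm_ae (Filter.Eventually.of_forall fun ξ => by simp)
  rw [← hnorm]
  have hb := hu.tsum_inner_products_le (hL'.toLp _)
  have hsum := hu.inner_products_summable (hL'.toLp _)
  have e : ∀ j, ‖∫ ξ, h ξ * u j ξ‖ₑ ^ 2 = ENNReal.ofReal (‖inner ℂ (u j) (hL'.toLp _)‖ ^ 2) :=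
    fun j => by
      rw [← hin, ENNReal.ofReal_pow (norm_nonneg _), norm_inner_symm, ofReal_norm]
  simp_rw [e]
  rw [← ENNReal.ofReal_tsum_of_nonneg (fun _ => by positivity) hsum, ← ofReal_norm,
    ← ENNReal.ofReal_pow (norm_nonneg _)]
  exact ENNReal.ofReal_le_ofReal hb

theorem integrable_mul_kernel_mul {X Y : Type*} [MeasurableSpace X] [MeasurableSpace Y]
    {μ : Measure X} {ν : Measure Y} [SFinite μ] [SFinite ν] {a : X → ℂ} {b : Y → ℂ}
    {c : X × Y → ℂ} (ha : Integrable a μ) (hb : Integrable b ν)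
    (hc : AEStronglyMeasurable c (μ.prod ν)) (hc1 : ∀ p, ‖c p‖ ≤ 1) :
    Integrable (fun p : X × Y => a p.1 * c p * b p.2) (μ.prod ν) := by
  refine (ha.norm.mul_prod hb.norm).mono'
    ((ha.aestronglyMeasurable.comp_fst.mul hc).mul hb.aestronglyMeasurable.comp_snd)
    (Filter.Eventually.of_forall fun p => ?_)
  rw [norm_mul, norm_mul]
  gcongr
  exact mul_le_of_le_one_right (norm_nonneg _) (hc1 p)

/-- Weighted `L²` norms of an integral operator in terms of the Gram kernel. -/
theorem lintegral_mul_enorm_sq_eq {X Y : Type*} [MeasurableSpace X] [MeasurableSpace Y]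
    {μ : Measure X} {ν : Measure Y} [SFinite μ] [SFinite ν] {g : X → ℝ} {b : Y → ℂ}
    {e : X → Y → ℂ} (hg : Integrable g μ) (hg0 : ∀ x, 0 ≤ g x) (hb : Integrable b ν)
    (he : Measurable (Function.uncurry e)) (he1 : ∀ x y, ‖e x y‖ ≤ 1) :
    ∫⁻ x, ENNReal.ofReal (g x) * ‖∫ y, e x y * b y ∂ν‖ₑ ^ 2 ∂μ =
      ‖∫ ξ, conj (b ξ) * ∫ η, (∫ x, g x * conj (e x ξ) * e x η ∂μ) * b η ∂ν ∂ν‖ₑ := by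
  set F : X → ℂ := fun x => ∫ y, e x y * b y ∂ν with hF
  have hFm : AEStronglyMeasurable F μ :=
    AEStronglyMeasurable.integral_prod_right' (f := fun p : X × Y => e p.1 p.2 * b p.2)
      (he.aestronglyMeasurable.mul hb.aestronglyMeasurable.comp_snd)
  have hFb : ∀ x, ‖F x‖ ≤ ∫ y, ‖b y‖ ∂ν := fun x =>
    norm_integral_le_of_norm_le hb.norm (Filter.Eventually.of_forall fun y => by
      rw [norm_mul]; exact mul_le_of_le_one_left (norm_nonneg _) (he1 x y))
  have hgc : Integrable (fun x => (g x : ℂ)) μ := hg.ofReal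
  have hgF : Integrable (fun x => (g x : ℂ) * F x) μ :=
    hgc.mul_bdd hFm (Filter.Eventually.of_forall hFb)
  have hgFF : Integrable (fun x => g x * ‖F x‖ ^ 2) μ :=
    hg.mul_bdd (c := (∫ y, ‖b y‖ ∂ν) ^ 2) (hFm.norm.pow 2) (Filter.Eventually.of_forall fun x => by
      rw [Real.norm_of_nonneg (by positivity)]
      exact pow_le_pow_left₀ (norm_nonneg _) (hFb x) 2)
  have s1 : ∫⁻ x, ENNReal.ofReal (g x) * ‖F x‖ₑ ^ 2 ∂μ = ‖∫ x, (g x * F x) * conj (F x) ∂μ‖ₑ := by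
    have e1 : ∀ x, (g x * F x) * conj (F x) = ((g x * ‖F x‖ ^ 2 : ℝ) : ℂ) := fun x => by
      rw [mul_assoc, Complex.mul_conj, Complex.normSq_eq_norm_sq]
      push_cast
      rfl
    simp_rw [e1]
    rw [integral_complex_ofReal, ← ofReal_norm, Complex.norm_real,
      Real.norm_of_nonneg (integral_nonneg fun x => mul_nonneg (hg0 x) (by positivity)),
      ofReal_integral_eq_lintegral_ofReal hgFF
        (Filter.Eventually.of_forall fun x => mul_nonneg (hg0 x) (by positivity))]
    refine lintegral_congr fun x => ?_
    rw [ENNReal.ofReal_mul (hg0 x), ENNReal.ofReal_pow (norm_nonneg _), ofReal_norm]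
  rw [s1]
  congr 1
  have s2 : ∀ x, (g x * F x) * conj (F x) =
      ∫ ξ, (g x * F x) * conj (e x ξ) * conj (b ξ) ∂ν := fun x => by
    rw [show conj (F x) = ∫ ξ, conj (e x ξ * b ξ) ∂ν from integral_conj.symm,
      ← integral_const_mul]
    simp_rw [map_mul, mul_assoc]
  have s3 : ∀ ξ, ∫ x, (g x * F x) * conj (e x ξ) * conj (b ξ) ∂μ =
      conj (b ξ) * ∫ η, (∫ x, g x * conj (e x ξ) * e x η ∂μ) * b η ∂ν := fun ξ => by
    rw [integral_mul_const, mul_comm]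
    congr 1
    have hei : Integrable (fun x => (g x : ℂ) * conj (e x ξ)) μ :=
      hgc.mul_bdd (c := 1) (Measurable.aestronglyMeasurable
        (Complex.continuous_conj.measurable.comp (he.comp measurable_prodMk_right)))
        (Filter.Eventually.of_forall fun x => by simpa using he1 x ξ)
    have s4 : ∀ x, g x * F x * conj (e x ξ) =
        ∫ η, g x * conj (e x ξ) * e x η * b η ∂ν := fun x => by
      rw [mul_right_comm, hF, ← integral_const_mul]
      simp_rw [mul_assoc]
    simp_rw [s4]
    rw [integral_integral_swap (integrable_mul_kernel_mul (c := fun p : X × Y => e p.1 p.2) hei hb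
      he.aestronglyMeasurable fun p => he1 _ _)]
    simp_rw [integral_mul_const]
  simp_rw [s2]
  rw [integral_integral_swap (integrable_mul_kernel_mul (b := fun ξ => conj (b ξ))
    (c := fun p : X × Y => conj (e p.1 p.2)) hgF
    ((LinearIsometryEquiv.integrable_comp_iff RCLike.conjLIE).2 hb)
    (Complex.continuous_conj.measurable.comp he).aestronglyMeasurable
    fun p => by simpa using he1 _ _)]
  simp_rw [s3]


/-! ### Frequency-localised waves and the duality step. -/

theorem DyadicCutoff.le_one (φ : DyadicCutoff) (t : ℝ) : φ.toFun t ≤ 1 := by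
  rcases le_or_gt t 0 with ht | ht
  · rw [image_eq_zero_of_notMem_tsupport (f := φ.toFun) fun h => by
      have := (φ.support h).1
      linarith]
    exact zero_le_one
  · simpa using le_hasSum (φ.partition t ht) 0 fun k _ => φ.nonneg _

section

variable (d : ℕ) (φ : DyadicCutoff) (k : ℤ)

theorem continuous_lpSymbol : Continuous (lpSymbol d φ k) := by
  have := φ.smooth.continuous
  unfold lpSymbol
  fun_prop

theorem norm_lpSymbol_le_one (ξ : EuclideanSpace ℝ (Fin d)) : ‖lpSymbol d φ k ξ‖ ≤ 1 := by
  rw [lpSymbol, Complex.norm_real, Real.norm_of_nonneg (φ.nonneg _)]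
  exact φ.le_one _

theorem lpSymbol_eq_zero {ξ : EuclideanSpace ℝ (Fin d)}
    (hξ : ξ ∉ Metric.closedBall 0 ((2 : ℝ) ^ k)) : lpSymbol d φ k ξ = 0 := by
  rw [lpSymbol, Complex.ofReal_eq_zero]
  refine image_eq_zero_of_notMem_tsupport fun h => hξ ?_
  have h2 := (φ.support h).2
  rw [div_lt_iff₀ (by positivity)] at h2
  rw [mem_closedBall_zero_iff]
  nlinarith [Real.pi_gt_three, norm_nonneg ξ]

theorem enorm_lpSymbol_le (ξ : EuclideanSpace ℝ (Fin d)) :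
    ‖lpSymbol d φ k ξ‖ₑ ≤ (Metric.closedBall 0 ((2 : ℝ) ^ k)).indicator 1 ξ := by
  by_cases h : ξ ∈ Metric.closedBall (0 : EuclideanSpace ℝ (Fin d)) ((2 : ℝ) ^ k)
  · rw [Set.indicator_of_mem h, Pi.one_apply, ← ofReal_norm]
    exact ENNReal.ofReal_le_one.2 (norm_lpSymbol_le_one d φ k ξ)
  · rw [Set.indicator_of_notMem h, lpSymbol_eq_zero d φ k h, enorm_zero]

theorem lintegral_enorm_lpSymbol_sq_lt_top : ∫⁻ ξ, ‖lpSymbol d φ k ξ‖ₑ ^ 2 < ⊤ := by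
  refine (lintegral_mono (g := (Metric.closedBall 0 ((2 : ℝ) ^ k)).indicator 1) fun ξ =>
    (pow_le_pow_left' (enorm_lpSymbol_le d φ k ξ) 2).trans ?_).trans_lt ?_
  · by_cases h : ξ ∈ Metric.closedBall (0 : EuclideanSpace ℝ (Fin d)) ((2 : ℝ) ^ k) <;> simp [h]
  · rw [lintegral_indicator_one Metric.isClosed_closedBall.measurableSet]
    exact measure_closedBall_lt_top

theorem memLp_two_lpSymbol : MemLp (lpSymbol d φ k) 2 := by
  refine ⟨(continuous_lpSymbol d φ k).aestronglyMeasurable, ?_⟩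
  have h := eLpNorm_nnreal_pow_eq_lintegral (p := 2) (f := lpSymbol d φ k) (μ := volume)
    (by norm_num)
  simp only [NNReal.coe_ofNat, ENNReal.coe_ofNat, ENNReal.rpow_ofNat] at h
  have h2 := lintegral_enorm_lpSymbol_sq_lt_top d φ k
  rw [← h] at h2
  simpa using h2

theorem integrable_lpSymbol_mul (u : L2 d) : Integrable fun ξ => lpSymbol d φ k ξ * u ξ :=
  (memLp_two_lpSymbol d φ k).integrable_mul (Lp.memLp u)

/-- The plane wave `exp(2πi(x·ξ + t|ξ|))` solving the half-wave equation. -/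
noncomputable def planeWave {d : ℕ} (x : EuclideanSpace ℝ (Fin d)) (t : ℝ) (ξ : EuclideanSpace ℝ (Fin d)) : ℂ :=
  Complex.exp (((2 * Real.pi * inner ℝ x ξ + t * (2 * Real.pi * ‖ξ‖) : ℝ) : ℂ) * Complex.I)

variable {d φ k}

theorem norm_planeWave (x : EuclideanSpace ℝ (Fin d)) (t : ℝ) (ξ : EuclideanSpace ℝ (Fin d)) :
    ‖planeWave x t ξ‖ = 1 :=
  Complex.norm_exp_ofReal_mul_I _

theorem continuous_planeWave :
    Continuous fun p : (EuclideanSpace ℝ (Fin d) × ℝ) × EuclideanSpace ℝ (Fin d) =>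
      planeWave p.1.1 p.1.2 p.2 := by
  unfold planeWave
  fun_prop

variable (d φ k)

theorem halfWave_lpProj (f : L2 d) (x : EuclideanSpace ℝ (Fin d)) (t : ℝ) :
    halfWave d (lpProj d φ k f) x t =
      ∫ ξ, planeWave x t ξ * (lpSymbol d φ k ξ * (𝓕 f : L2 d) ξ) := by
  refine integral_congr_ae ?_
  filter_upwards [fourier_lpProj d φ k f] with ξ hξ
  rw [hξ, planeWave]

theorem continuous_halfWave_lpProj (f : L2 d) :
    Continuous fun p : EuclideanSpace ℝ (Fin d) × ℝ => halfWave d (lpProj d φ k f) p.1 p.2 := by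
  simp_rw [halfWave_lpProj]
  have hi := integrable_lpSymbol_mul d φ k (𝓕 f)
  refine continuous_of_dominated (fun p => ?_) (fun p => ?_) hi.norm ?_
  · exact (continuous_planeWave.comp (Continuous.prodMk_right p)).aestronglyMeasurable.mul
      hi.aestronglyMeasurable
  · exact Filter.Eventually.of_forall fun ξ => by rw [norm_mul, norm_planeWave, one_mul]
  · exact Filter.Eventually.of_forall fun ξ =>
      (continuous_planeWave.comp (Continuous.prodMk_left ξ)).mul continuous_const

variable {d} {ι : Type} {f : ι → L2 d}

theorem orthonormal_fourier (hf : Orthonormal ℂ f) : Orthonormal ℂ fun j => (𝓕 (f j) : L2 d) :=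
  hf.comp_linearIsometry (Lp.fourierTransformₗᵢ (EuclideanSpace ℝ (Fin d)) ℂ).toLinearIsometry

/-- Bessel for the single function `planeWave x t * lpSymbol d φ k`. The bound is crude in `k`, but
uniform in `(x, t)`; it serves convergence and a priori finiteness. -/
theorem tsum_enorm_halfWave_sq_le (hf : Orthonormal ℂ f) (x : EuclideanSpace ℝ (Fin d)) (t : ℝ) :
    ∑' j, ‖halfWave d (lpProj d φ k (f j)) x t‖ₑ ^ 2 ≤ ∫⁻ ξ, ‖lpSymbol d φ k ξ‖ₑ ^ 2 := by
  have h := tsum_enorm_integral_mul_sq_le (orthonormal_fourier hf)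
    (h := fun ξ => planeWave x t ξ * lpSymbol d φ k ξ)
    ((continuous_planeWave.comp (Continuous.prodMk_right (x, t))).aestronglyMeasurable.mul
      (continuous_lpSymbol d φ k).aestronglyMeasurable)
  have e : ∀ ξ, ‖planeWave x t ξ * lpSymbol d φ k ξ‖ₑ = ‖lpSymbol d φ k ξ‖ₑ := fun ξ => by
    rw [← ofReal_norm, norm_mul, norm_planeWave, one_mul, ofReal_norm]
  simp_rw [e, mul_assoc] at h
  simpa only [halfWave_lpProj] using h

theorem enorm_gram_eq_graphFourier (g : EuclideanSpace ℝ (Fin d) → ℝ)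
    (T : EuclideanSpace ℝ (Fin d) → ℝ) (ξ η : EuclideanSpace ℝ (Fin d)) :
    ‖∫ x, g x * conj (planeWave x (T x) ξ) * planeWave x (T x) η‖ₑ =
      ‖graphFourier (fun x => (g x : ℂ)) T (‖η‖ - ‖ξ‖) (η - ξ)‖ₑ := by
  rw [← RCLike.enorm_conj, ← integral_conj, graphFourier]
  congr 1
  refine integral_congr_ae (Filter.Eventually.of_forall fun x => ?_)
  simp only [planeWave, map_mul, Complex.conj_ofReal, ← Complex.exp_conj,
    map_neg, Complex.conj_I]
  rw [mul_assoc, ← Complex.exp_add, inner_sub_right]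
  congr 2
  push_cast
  ring

/-- The duality step: the weighted norms of an orthonormal family of wave packets are controlled by
the Hilbert-Schmidt norm of the Gram kernel. -/
theorem tsum_lintegral_halfWave_sq_le [Countable ι] (hf : Orthonormal ℂ f) {g : EuclideanSpace ℝ (Fin d) → ℝ}
    {T : EuclideanSpace ℝ (Fin d) → ℝ} (hg : Integrable g) (hgm : Measurable g)
    (hg0 : ∀ x, 0 ≤ g x) (hT : Measurable T) :
    ∑' j, (∫⁻ x, ENNReal.ofReal (g x) * ‖halfWave d (lpProj d φ k (f j)) x (T x)‖ₑ ^ 2) ^ 2 ≤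
      ∫⁻ ξ in Metric.closedBall 0 ((2 : ℝ) ^ k), ∫⁻ η in Metric.closedBall 0 ((2 : ℝ) ^ k),
        ‖graphFourier (fun x => (g x : ℂ)) T (‖η‖ - ‖ξ‖) (η - ξ)‖ₑ ^ 2 := by
  set ψ := lpSymbol d φ k with hψ
  set u : ι → L2 d := fun j => 𝓕 (f j) with hu
  set A : EuclideanSpace ℝ (Fin d) → EuclideanSpace ℝ (Fin d) → ℂ := fun ξ η =>
    ∫ x, g x * conj (planeWave x (T x) ξ) * planeWave x (T x) η with hA
  have hψm : Measurable ψ := (continuous_lpSymbol d φ k).measurable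
  have hem : Measurable (Function.uncurry fun x ξ => planeWave x (T x) ξ) :=
    continuous_planeWave.measurable.comp
      (f := fun p : EuclideanSpace ℝ (Fin d) × EuclideanSpace ℝ (Fin d) => ((p.1, T p.1), p.2))
      (by fun_prop)
  have hAm : Measurable (Function.uncurry A) := by
    refine (StronglyMeasurable.integral_prod_right
      (f := fun (p : EuclideanSpace ℝ (Fin d) × EuclideanSpace ℝ (Fin d)) x =>
        g x * conj (planeWave x (T x) p.1) * planeWave x (T x) p.2)
      (Measurable.stronglyMeasurable ?_)).measurable
    have h1 : Measurable fun q : (EuclideanSpace ℝ (Fin d) × EuclideanSpace ℝ (Fin d)) ×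
        EuclideanSpace ℝ (Fin d) => planeWave q.2 (T q.2) q.1.1 :=
      hem.comp (f := fun q : (EuclideanSpace ℝ (Fin d) × EuclideanSpace ℝ (Fin d)) ×
        EuclideanSpace ℝ (Fin d) => (q.2, q.1.1)) (by fun_prop)
    have h2 : Measurable fun q : (EuclideanSpace ℝ (Fin d) × EuclideanSpace ℝ (Fin d)) ×
        EuclideanSpace ℝ (Fin d) => planeWave q.2 (T q.2) q.1.2 :=
      hem.comp (f := fun q : (EuclideanSpace ℝ (Fin d) × EuclideanSpace ℝ (Fin d)) ×
        EuclideanSpace ℝ (Fin d) => (q.2, q.1.2)) (by fun_prop)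
    exact ((Complex.measurable_ofReal.comp (hgm.comp measurable_snd)).mul
      (Complex.continuous_conj.measurable.comp h1)).mul h2
  have hkm : Measurable fun p : EuclideanSpace ℝ (Fin d) × EuclideanSpace ℝ (Fin d) =>
      ψ p.1 * A p.1 p.2 * ψ p.2 :=
    ((hψm.comp measurable_fst).mul hAm).mul (hψm.comp measurable_snd)
  have hBm : ∀ j, AEStronglyMeasurable fun ξ => ∫ η, ψ ξ * A ξ η * ψ η * u j η := fun j =>
    AEStronglyMeasurable.integral_prod_right'
      (f := fun p : EuclideanSpace ℝ (Fin d) × EuclideanSpace ℝ (Fin d) =>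
        ψ p.1 * A p.1 p.2 * ψ p.2 * u j p.2)
      (hkm.aestronglyMeasurable.mul (Lp.aestronglyMeasurable (u j)).comp_snd)
  have step : ∀ j,
      (∫⁻ x, ENNReal.ofReal (g x) * ‖halfWave d (lpProj d φ k (f j)) x (T x)‖ₑ ^ 2) ^ 2 ≤
        ∫⁻ ξ, ‖∫ η, ψ ξ * A ξ η * ψ η * u j η‖ₑ ^ 2 := fun j => by
    simp_rw [halfWave_lpProj]
    rw [lintegral_mul_enorm_sq_eq hg hg0 (integrable_lpSymbol_mul d φ k (u j)) hem
      fun x ξ => (norm_planeWave _ _ _).le]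
    have e1 : ∀ ξ, ‖conj (ψ ξ * u j ξ) * ∫ η, A ξ η * (ψ η * u j η)‖ₑ =
        ‖u j ξ‖ₑ * ‖∫ η, ψ ξ * A ξ η * ψ η * u j η‖ₑ := fun ξ => by
      have e2 : ∫ η, ψ ξ * A ξ η * ψ η * u j η = ψ ξ * ∫ η, A ξ η * (ψ η * u j η) := by
        rw [← integral_const_mul]
        congr 1 with η
        ring
      rw [e2, ← enorm_mul, ← ofReal_norm, ← ofReal_norm]
      simp only [norm_mul, RCLike.norm_conj]
      congr 1
      ring
    refine (pow_le_pow_left' (enorm_integral_le_lintegral_enorm _) 2).trans ?_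
    rw [lintegral_congr e1]
    -- Cauchy–Schwarz in `ξ` replaces the diagonal matrix entry at `u j` by the norm of the operator
    -- applied to `u j`, since `u j` is a unit vector.
    refine (sq_lintegral_mul_le (Lp.aestronglyMeasurable (u j)).enorm (hBm j).enorm).trans ?_
    have h1 : ∫⁻ ξ, ‖u j ξ‖ₑ ^ 2 = 1 := by
      have h := eLpNorm_nnreal_pow_eq_lintegral (p := 2) (f := u j) (μ := volume) (by norm_num)
      simp only [NNReal.coe_ofNat, ENNReal.coe_ofNat, ENNReal.rpow_ofNat] at h
      rw [← h, ← Lp.enorm_def, ← ofReal_norm, (orthonormal_fourier hf).1 j]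
      simp
    rw [h1, one_mul]
  calc _ ≤ ∑' j, ∫⁻ ξ, ‖∫ η, ψ ξ * A ξ η * ψ η * u j η‖ₑ ^ 2 := ENNReal.tsum_le_tsum step
    _ = ∫⁻ ξ, ∑' j, ‖∫ η, ψ ξ * A ξ η * ψ η * u j η‖ₑ ^ 2 := by
        exact (lintegral_tsum fun j => (hBm j).enorm.pow_const 2).symm
    -- Bessel in `η` for each frozen `ξ`: summing over the orthonormal family leaves the
    -- Hilbert–Schmidt norm.
    _ ≤ ∫⁻ ξ, ∫⁻ η, ‖ψ ξ * A ξ η * ψ η‖ₑ ^ 2 := lintegral_mono fun ξ =>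
        tsum_enorm_integral_mul_sq_le (orthonormal_fourier hf)
          (hkm.comp measurable_prodMk_left).aestronglyMeasurable
    _ ≤ _ := by
        rw [← lintegral_indicator Metric.isClosed_closedBall.measurableSet]
        refine lintegral_mono fun ξ => ?_
        by_cases hξ : ξ ∈ Metric.closedBall (0 : EuclideanSpace ℝ (Fin d)) ((2 : ℝ) ^ k)
        swap
        · simp [hψ, lpSymbol_eq_zero d φ k hξ]
        rw [Set.indicator_of_mem hξ, ← lintegral_indicator Metric.isClosed_closedBall.measurableSet]
        refine lintegral_mono fun η => ?_
        by_cases hη : η ∈ Metric.closedBall (0 : EuclideanSpace ℝ (Fin d)) ((2 : ℝ) ^ k)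
        swap
        · simp [hψ, lpSymbol_eq_zero d φ k hη]
        rw [Set.indicator_of_mem hη, ← enorm_gram_eq_graphFourier]
        refine pow_le_pow_left' ?_ 2
        rw [← ofReal_norm, ← ofReal_norm, norm_mul, norm_mul]
        refine ENNReal.ofReal_le_ofReal ?_
        calc ‖ψ ξ‖ * ‖A ξ η‖ * ‖ψ η‖ ≤ 1 * ‖A ξ η‖ * 1 := by
              gcongr <;> exact norm_lpSymbol_le_one d φ k _
          _ = _ := by rw [one_mul, mul_one]

end


/-! ### The density with absolute weights, and its bound along a graph. -/

section

variable {d : ℕ} (φ : DyadicCutoff) (k : ℤ) {ι : Type} (f : ι → L2 d)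

/-- The extended nonnegative density `∑ⱼ |λⱼ| |e^{it√(-Δ)} P_k f_j(x)|²`. -/
noncomputable def absDensity (lam : ι → ℂ) (x : EuclideanSpace ℝ (Fin d)) (t : ℝ) : ℝ≥0∞ :=
  ∑' j, ‖lam j‖ₑ * ‖halfWave d (lpProj d φ k (f j)) x t‖ₑ ^ 2

theorem measurable_absDensity [Countable ι] (lam : ι → ℂ) :
    Measurable fun p : EuclideanSpace ℝ (Fin d) × ℝ => absDensity φ k f lam p.1 p.2 :=
  Measurable.tsum fun j =>
    ((continuous_halfWave_lpProj d φ k (f j)).measurable.enorm.pow_const 2).const_mul _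

/-- A series of nonnegative continuous terms. Lower semicontinuity is enough to compute the supremum
over times on a countable dense set. -/
theorem lowerSemicontinuous_absDensity (lam : ι → ℂ) (x : EuclideanSpace ℝ (Fin d)) :
    LowerSemicontinuous (absDensity φ k f lam x) := by
  refine lowerSemicontinuous_tsum fun j => Continuous.lowerSemicontinuous ?_
  have h := (continuous_halfWave_lpProj d φ k (f j)).comp (Continuous.prodMk_right x)
  exact (ENNReal.continuous_const_mul enorm_ne_top).comp
    ((ENNReal.continuous_pow 2).comp h.enorm)

theorem enorm_density_le (lam : ι → ℂ) (x : EuclideanSpace ℝ (Fin d)) (t : ℝ) :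
    ‖density d φ k lam f x t‖ₑ ≤ absDensity φ k f lam x t := by
  refine enorm_tsum_le_tsum_enorm.trans (le_of_eq (tsum_congr fun j => ?_))
  rw [enorm_mul, ← ofReal_norm ((‖_‖ ^ 2 : ℝ) : ℂ), Complex.norm_real, norm_pow, norm_norm,
    ENNReal.ofReal_pow (norm_nonneg _), ofReal_norm]

variable {f}

theorem absDensity_le (hf : Orthonormal ℂ f) (lam : lp (fun _ : ι => ℂ) 2)
    (x : EuclideanSpace ℝ (Fin d)) (t : ℝ) :
    absDensity φ k f lam x t ≤ ‖lam‖ₑ * ∫⁻ ξ, ‖lpSymbol d φ k ξ‖ₑ ^ 2 := by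
  refine le_trans ?_ (mul_le_mul_right (tsum_enorm_halfWave_sq_le φ k hf x t) _)
  rw [← ENNReal.tsum_mul_left]
  refine ENNReal.tsum_le_tsum fun j => mul_le_mul_left ?_ _
  rw [← ofReal_norm, ← ofReal_norm]
  exact ENNReal.ofReal_le_ofReal (lp.norm_apply_le_norm (by norm_num) lam j)

theorem absDensity_bound_lt_top (lam : lp (fun _ : ι => ℂ) 2) :
    ‖lam‖ₑ * ∫⁻ ξ, ‖lpSymbol d φ k ξ‖ₑ ^ 2 < ⊤ :=
  ENNReal.mul_lt_top enorm_lt_top (lintegral_enorm_lpSymbol_sq_lt_top d φ k)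

theorem summable_density (hf : Orthonormal ℂ f) (lam : lp (fun _ : ι => ℂ) 2)
    (x : EuclideanSpace ℝ (Fin d)) (t : ℝ) :
    Summable fun j =>
      lam j * ((‖halfWave d (lpProj d φ k (f j)) x t‖ ^ 2 : ℝ) : ℂ) := by
  have h := ((absDensity_le φ k hf lam x t).trans_lt (absDensity_bound_lt_top φ k lam)).ne
  refine Summable.of_norm ((ENNReal.summable_toReal h).congr fun j => ?_)
  rw [norm_mul, Complex.norm_real]
  simp

theorem measurable_density [Countable ι] (lam : ι → ℂ) :
    Measurable fun p : EuclideanSpace ℝ (Fin d) × ℝ => density d φ k lam f p.1 p.2 :=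
  Measurable.tsum fun j => (Complex.measurable_ofReal.comp
    ((continuous_halfWave_lpProj d φ k (f j)).measurable.norm.pow_const 2)).const_mul _

theorem tsum_enorm_sq_lp (lam : lp (fun _ : ι => ℂ) 2) : ∑' j, ‖lam j‖ₑ ^ 2 = ‖lam‖ₑ ^ 2 := by
  have h := lp.hasSum_norm (by norm_num) lam
  simp only [ENNReal.toReal_ofNat, Real.rpow_ofNat] at h
  simp_rw [← ofReal_norm, ← ENNReal.ofReal_pow (norm_nonneg _)]
  rw [← ENNReal.ofReal_tsum_of_nonneg (fun _ => by positivity) h.summable, h.tsum_eq]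

theorem sq_tsum_mul_le (a b : ι → ℝ≥0∞) :
    (∑' j, a j * b j) ^ 2 ≤ (∑' j, a j ^ 2) * ∑' j, b j ^ 2 := by
  let _ : MeasurableSpace ι := ⊤
  simpa only [lintegral_count] using sq_lintegral_mul_le (μ := Measure.count)
    (f := a) (g := b) measurable_from_top.aemeasurable measurable_from_top.aemeasurable

/-- The estimate at a measurable choice of times `t = T(x)`. -/
theorem exists_lintegral_absDensity_graph_le {d : ℕ} (hd : 2 ≤ d) {s : ℝ}
    (hs : max ((d : ℝ) / 4) (5 / 8) < s) :
    ∃ C : ℝ, 0 ≤ C ∧ ∀ (φ : DyadicCutoff) (k : ℤ), 0 ≤ k → ∀ (ι : Type) [Countable ι]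
      (f : ι → L2 d), Orthonormal ℂ f → ∀ (lam : lp (fun _ : ι => ℂ) 2)
      (T : EuclideanSpace ℝ (Fin d) → ℝ), Measurable T → (∀ x, |T x| ≤ 1) →
      ∫⁻ x in Metric.ball 0 1, absDensity φ k f lam x (T x) ^ 2 ≤
        ENNReal.ofReal (C * ((2 : ℝ) ^ k) ^ (4 * s)) * ‖lam‖ₑ ^ 2 := by
  obtain ⟨C, hC, hmain⟩ := exists_lintegral_graphFourier_le hd hs
  refine ⟨C, hC, fun φ k hk ι _ f hf lam T hT hT1 => ?_⟩
  set M := ‖lam‖ₑ * ∫⁻ ξ, ‖lpSymbol d φ k ξ‖ₑ ^ 2 with hM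
  have hMtop : M < ⊤ := absDensity_bound_lt_top φ k lam
  have hle : ∀ x, absDensity φ k f lam x (T x) ≤ M := fun x => absDensity_le φ k hf lam x (T x)
  have hne : ∀ x, absDensity φ k f lam x (T x) ≠ ⊤ := fun x => ((hle x).trans_lt hMtop).ne
  have hρm : Measurable fun x => absDensity φ k f lam x (T x) :=
    (measurable_absDensity φ k f lam).comp (f := fun x => (x, T x)) (by fun_prop)
  set B := Metric.ball (0 : EuclideanSpace ℝ (Fin d)) 1 with hB
  set g : EuclideanSpace ℝ (Fin d) → ℝ :=
    B.indicator fun x => (absDensity φ k f lam x (T x)).toReal with hg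
  have hgm : Measurable g := hρm.ennreal_toReal.indicator measurableSet_ball
  have hg0 : ∀ x, 0 ≤ g x := fun x => Set.indicator_nonneg (fun _ _ => ENNReal.toReal_nonneg) x
  have hgo : ∀ x, ENNReal.ofReal (g x) =
      B.indicator (fun x => absDensity φ k f lam x (T x)) x := fun x => by
    by_cases hx : x ∈ B
    · simp only [hg, Set.indicator_of_mem hx, ENNReal.ofReal_toReal (hne x)]
    · simp only [hg, Set.indicator_of_notMem hx, ENNReal.ofReal_zero]
  have hgs : ∀ x, x ∉ B → (g x : ℂ) = 0 := fun x hx => by simp [hg, hx]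
  have hgK : ∀ x, ‖(g x : ℂ)‖ ≤ M.toReal := fun x => by
    rw [Complex.norm_real, Real.norm_of_nonneg (hg0 x)]
    exact Set.indicator_le' (fun x _ => ENNReal.toReal_mono hMtop.ne (hle x))
      (fun _ _ => ENNReal.toReal_nonneg) x
  have hgcm : Measurable fun x => (g x : ℂ) := Complex.measurable_ofReal.comp hgm
  have hgi : Integrable g := (integrable_of_bound_of_support hgcm hgK hgs).re
  have hge : ∀ x, ‖(g x : ℂ)‖ₑ = ENNReal.ofReal (g x) := fun x => by
    rw [← ofReal_norm, Complex.norm_real, Real.norm_of_nonneg (hg0 x)]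
  set X := ∫⁻ x in B, absDensity φ k f lam x (T x) ^ 2 with hX
  have hXtop : X ≠ ⊤ := by
    refine ((setLIntegral_mono' (g := fun _ => M ^ 2) measurableSet_ball fun x _ =>
      pow_le_pow_left' (hle x) 2).trans_lt ?_).ne
    rw [setLIntegral_const]
    exact ENNReal.mul_lt_top (ENNReal.pow_lt_top hMtop) measure_ball_lt_top
  have hXg : ∫⁻ x, ‖(g x : ℂ)‖ₑ ^ 2 = X := by
    rw [hX, ← lintegral_indicator (s := B) measurableSet_ball]
    refine lintegral_congr fun x => ?_
    rw [hge, hgo]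
    by_cases hx : x ∈ B <;> simp [hx]
  have hXs : X = ∑' j, ‖lam j‖ₑ *
      ∫⁻ x, ENNReal.ofReal (g x) * ‖halfWave d (lpProj d φ k (f j)) x (T x)‖ₑ ^ 2 := by
    have hFm : ∀ j, Measurable fun x => ‖halfWave d (lpProj d φ k (f j)) x (T x)‖ₑ ^ 2 := fun j =>
      ((continuous_halfWave_lpProj d φ k (f j)).measurable.comp
        (f := fun x => (x, T x)) (by fun_prop)).enorm.pow_const 2
    have hm : ∀ j, Measurable fun x =>
        ENNReal.ofReal (g x) * ‖halfWave d (lpProj d φ k (f j)) x (T x)‖ₑ ^ 2 := fun j =>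
      hgm.ennreal_ofReal.mul (hFm j)
    refine Eq.trans ?_ (tsum_congr fun j => lintegral_const_mul ‖lam j‖ₑ (hm j))
    rw [← lintegral_tsum fun j => ((hm j).const_mul _).aemeasurable, hX,
      ← lintegral_indicator (s := B) measurableSet_ball]
    refine lintegral_congr fun x => ?_
    rw [tsum_congr fun j => mul_left_comm ‖lam j‖ₑ (ENNReal.ofReal (g x))
      (‖halfWave d (lpProj d φ k (f j)) x (T x)‖ₑ ^ 2), ENNReal.tsum_mul_left, hgo]
    by_cases hx : x ∈ B
    · rw [Set.indicator_of_mem hx, Set.indicator_of_mem hx, sq (absDensity φ k f lam x (T x))]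
      rfl
    · simp only [Set.indicator_of_notMem hx, zero_mul]
  -- The test function `g` is the density itself, so `X` reappears on the right as `‖g‖₂²`.
  have hX2 : X ^ 2 ≤ ‖lam‖ₑ ^ 2 * (ENNReal.ofReal (C * ((2 : ℝ) ^ k) ^ (4 * s)) * X) := by
    conv_lhs => rw [hXs]
    refine (sq_tsum_mul_le _ _).trans ?_
    rw [tsum_enorm_sq_lp]
    gcongr
    refine (tsum_lintegral_halfWave_sq_le φ k hf hgi hgm hg0 hT).trans ?_
    rw [← hXg]
    exact hmain _ T _ _ hgcm hT hgK hgs hT1 (one_le_zpow₀ (by norm_num) hk)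
  by_cases hX0 : X = 0
  · rw [hX0]; exact zero_le
  rw [← mul_assoc, sq, mul_comm (‖lam‖ₑ ^ 2)] at hX2
  exact (ENNReal.mul_le_mul_iff_left hX0 hXtop).1 hX2

end

/-! ### From measurable times to the supremum. -/

/-- Measurable selection of an almost optimal time among the first `n` ones. -/
theorem exists_measurable_selection {X : Type*} [MeasurableSpace X] {ρ : X → ℝ → ℝ≥0∞}
    (hρ : Measurable fun p : X × ℝ => ρ p.1 p.2) (q : ℕ → ℝ) :
    ∃ T : ℕ → X → ℝ, (∀ n, Measurable (T n)) ∧ (∀ n x, T n x ∈ Set.range q) ∧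
      (∀ x, Monotone fun n => ρ x (T n x)) ∧ ∀ n x, ρ x (q n) ≤ ρ x (T n x) := by
  classical
  let T : ℕ → X → ℝ := fun n => Nat.rec (fun _ => q 0)
    (fun n S x => if ρ x (S x) < ρ x (q (n + 1)) then q (n + 1) else S x) n
  have hT : ∀ n x, T (n + 1) x =
    if ρ x (T n x) < ρ x (q (n + 1)) then q (n + 1) else T n x := fun n x => rfl
  refine ⟨T, fun n => ?_, fun n => ?_, fun x => monotone_nat_of_le_succ fun n => ?_, fun n x => ?_⟩
  · induction n with
    | zero => exact measurable_const
    | succ n ih =>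
      refine Measurable.ite (measurableSet_lt ?_ ?_) measurable_const ih
      · exact hρ.comp (f := fun x => (x, T n x)) (measurable_id.prodMk ih)
      · exact hρ.comp (f := fun x => (x, q (n + 1))) (by fun_prop)
  · induction n with
    | zero => exact fun x => ⟨0, rfl⟩
    | succ n ih =>
      intro x
      rw [hT]
      split_ifs
      exacts [⟨n + 1, rfl⟩, ih x]
  · rw [hT]
    split_ifs with h
    exacts [h.le, le_rfl]
  · cases n with
    | zero => exact le_rfl
    | succ n =>
      rw [hT]
      split_ifs with h
      exacts [le_rfl, not_lt.1 h]

/-- The supremum over a compact interval can be taken along a sequence of measurable times. -/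
theorem lintegral_iSup_sq_le {X : Type*} [MeasurableSpace X] {μ : Measure X} {ρ : X → ℝ → ℝ≥0∞}
    (hρ : Measurable fun p : X × ℝ => ρ p.1 p.2) (hc : ∀ x, LowerSemicontinuous (ρ x))
    {Q : ℝ≥0∞} (hQ : ∀ T : X → ℝ, Measurable T → (∀ x, T x ∈ Set.Icc (0 : ℝ) 1) →
      ∫⁻ x, ρ x (T x) ^ 2 ∂μ ≤ Q) :
    ∫⁻ x, (⨆ t ∈ Set.Icc (0 : ℝ) 1, ρ x t) ^ 2 ∂μ ≤ Q := by
  let q : ℕ → ℝ := fun n => (TopologicalSpace.denseSeq (Set.Icc (0 : ℝ) 1) n : ℝ)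
  obtain ⟨T, hTm, hTr, hTmono, hTq⟩ := exists_measurable_selection hρ q
  have hTI : ∀ n x, T n x ∈ Set.Icc (0 : ℝ) 1 := fun n x => by
    obtain ⟨i, hi⟩ := hTr n x
    rw [← hi]
    exact Subtype.property _
  have hsup : ∀ x, ⨆ t ∈ Set.Icc (0 : ℝ) 1, ρ x t ≤ ⨆ n, ρ x (T n x) := fun x => by
    refine iSup₂_le fun t ht => ?_
    -- A sublevel set of a lower semicontinuous function is closed; it contains the dense sequence,
    -- hence the whole interval.
    have hcl : IsClosed {t : Set.Icc (0 : ℝ) 1 | ρ x t ≤ ⨆ n, ρ x (T n x)} :=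
      (lowerSemicontinuous_iff_isClosed_preimage.1 (hc x) _).preimage continuous_subtype_val
    have hd := (TopologicalSpace.denseRange_denseSeq (Set.Icc (0 : ℝ) 1)).closure_eq
    have hsub := closure_minimal (s := Set.range (TopologicalSpace.denseSeq (Set.Icc (0 : ℝ) 1)))
      (by
        rintro _ ⟨n, rfl⟩
        exact (hTq n x).trans (le_iSup (fun n => ρ x (T n x)) n)) hcl
    rw [hd] at hsub
    exact hsub (Set.mem_univ (⟨t, ht⟩ : Set.Icc (0 : ℝ) 1))
  calc ∫⁻ x, (⨆ t ∈ Set.Icc (0 : ℝ) 1, ρ x t) ^ 2 ∂μ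
      ≤ ∫⁻ x, ⨆ n, ρ x (T n x) ^ 2 ∂μ := by
        refine lintegral_mono fun x => (pow_le_pow_left' (hsup x) 2).trans (le_of_eq ?_)
        exact ENNReal.iSup_pow _ _
    _ = ⨆ n, ∫⁻ x, ρ x (T n x) ^ 2 ∂μ := by
        refine lintegral_iSup (fun n => ?_) fun m n hmn x => pow_le_pow_left' (hTmono x hmn) 2
        exact (hρ.comp (f := fun x => (x, T n x)) (measurable_id.prodMk (hTm n))).pow_const 2
    _ ≤ Q := iSup_le fun n => hQ _ (hTm n) (hTI n)

end HalfWave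

/-! ### Conclusion. -/

theorem proposition3p1 (d : ℕ) (hd : 2 ≤ d) (φ : HalfWave.DyadicCutoff) (s : ℝ)
    (hs : max ((d : ℝ) / 4) (5 / 8) < s) :
    ∃ C : ℝ, 0 < C ∧
      ∀ (k : ℤ), 1 ≤ k →
      ∀ (ι : Type) [Countable ι] (f : ι → HalfWave.L2 d), Orthonormal ℂ f →
      ∀ lam : lp (fun _ : ι => ℂ) 2,
        (∀ (x : EuclideanSpace ℝ (Fin d)) (t : ℝ), Summable fun j =>
          lam j * ((‖HalfWave.halfWave d (HalfWave.lpProj d φ k (f j)) x t‖ ^ 2 : ℝ) : ℂ)) ∧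
        Measurable (fun z : EuclideanSpace ℝ (Fin d) × ℝ =>
          HalfWave.density d φ k lam f z.1 z.2) ∧
        HalfWave.mixedNorm 2 ∞
            (volume.restrict (Metric.ball (0 : EuclideanSpace ℝ (Fin d)) 1))
            (volume.restrict (Set.Icc (0 : ℝ) 1))
            (HalfWave.density d φ k lam f)
          ≤ ENNReal.ofReal (C * (2 : ℝ) ^ (2 * s * (k : ℝ)) * ‖lam‖) := by
  obtain ⟨C, hC, hmain⟩ := HalfWave.exists_lintegral_absDensity_graph_le hd hs
  -- The square root comes from passing from `X` to the norm; adding `1` keeps the constant positive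
  -- when `C = 0`.
  refine ⟨√C + 1, by positivity, fun k hk ι _ f hf lam => ⟨HalfWave.summable_density φ k hf lam,
    HalfWave.measurable_density φ k lam, ?_⟩⟩
  have hpt : ∀ x, eLpNorm (fun t => HalfWave.density d φ k lam f x t) ∞
      (volume.restrict (Set.Icc (0 : ℝ) 1)) ≤
        ⨆ t ∈ Set.Icc (0 : ℝ) 1, HalfWave.absDensity φ k f lam x t := fun x => by
    rw [eLpNorm_exponent_top]
    refine essSup_le_of_ae_le _ ((ae_restrict_iff' measurableSet_Icc).2
      (Filter.Eventually.of_forall fun t ht => ?_))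
    exact (HalfWave.enorm_density_le φ k f lam x t).trans
      (le_iSup₂ (f := fun t _ => HalfWave.absDensity φ k f lam x t) t ht)
  have hpow : ((2 : ℝ) ^ k) ^ (4 * s) = ((2 : ℝ) ^ (2 * s * (k : ℝ))) ^ 2 := by
    rw [← Real.rpow_intCast, ← Real.rpow_mul (by norm_num), ← Real.rpow_mul_natCast (by norm_num)]
    congr 1
    push_cast
    ring
  have hsq : HalfWave.mixedNorm 2 ∞
      (volume.restrict (Metric.ball (0 : EuclideanSpace ℝ (Fin d)) 1))
      (volume.restrict (Set.Icc (0 : ℝ) 1)) (HalfWave.density d φ k lam f) ^ 2 ≤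
        ENNReal.ofReal ((√C + 1) * (2 : ℝ) ^ (2 * s * (k : ℝ)) * ‖lam‖) ^ 2 := by
    have h := eLpNorm_nnreal_pow_eq_lintegral (p := 2) (f := fun x => eLpNorm
      (fun t => HalfWave.density d φ k lam f x t) ∞ (volume.restrict (Set.Icc (0 : ℝ) 1)))
      (μ := volume.restrict (Metric.ball (0 : EuclideanSpace ℝ (Fin d)) 1)) (by norm_num)
    simp only [NNReal.coe_ofNat, ENNReal.coe_ofNat, ENNReal.rpow_ofNat, enorm_eq_self] at h
    rw [HalfWave.mixedNorm, h]
    refine (lintegral_mono fun x => pow_le_pow_left' (hpt x) 2).trans ?_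
    refine (HalfWave.lintegral_iSup_sq_le (HalfWave.measurable_absDensity φ k f lam)
      (HalfWave.lowerSemicontinuous_absDensity φ k f lam) fun T hT hT1 =>
        hmain φ k (by omega) ι f hf lam T hT fun x =>
          abs_le.2 ⟨by linarith [(hT1 x).1], (hT1 x).2⟩).trans ?_
    rw [← ofReal_norm, ← ENNReal.ofReal_pow (norm_nonneg _), ← ENNReal.ofReal_mul (by positivity),
      ← ENNReal.ofReal_pow (by positivity), hpow, mul_pow, mul_pow]
    refine ENNReal.ofReal_le_ofReal ?_
    gcongr
    nlinarith [Real.sq_sqrt hC, Real.sqrt_nonneg C]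
  exact (ENNReal.pow_le_pow_left_iff two_ne_zero).1 hsq
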